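/- Let $\Omega$ be a bounded domain (open, connected) in $\mathbb{R}^N$, let $T>0$, let $p\in(1,\infty]$ and let $q\in[1,\infty)$ be the conjugate exponent, $\frac1p+\frac1q=1$. Let $u\in L^1(0,T;W^{1,q}(\Omega;\mathbb{R}^N))$ be weakly divergence-free, i.e. for almost every $t\in(0,T)$ one has $\int_\Omega u(t,x)\cdot\nabla\varphi(x)\,dx=0$ for all $\varphi\in C_c^\infty(\Omega)$ (no boundary condition on $u$ is assumed). Let $\rho_0\in L^p(\Omega)$, and let $\rho\in L^\infty(0,T;L^p(\Omega))$ be a weak solution of $\rho_t-u\cdot\nabla\rho=0$ in $(0,T)\times\Omega$, $\rho(0)=\rho_0$, that is, $$-\int_0^T\!\!\int_\Omega \rho\,\phi_t\,dx\,dt-\int_\Omega\rho_0(x)\,\phi(0,x)\,dx+\int_0^T\!\!\int_\Omega\rho\,(u\cdot\nabla\phi)\,dx\,dt=0\qquad\text{for every }\phi\in C_c^\infty([0,T)\times\Omega).$$ Then $\rho$ is a renormalized solution of the same problem: for every $\beta\in C^1(\mathbb{R};\mathbb{R})$ with $\beta$ and $\beta'$ bounded, $$-\int_0^T\!\!\int_\Omega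 \beta(\rho)\,\phi_t\,dx\,dt-\int_\Omega\beta(\rho_0(x))\,\phi(0,x)\,dx+\int_0^T\!\!\int_\Omega\beta(\rho)\,(u\cdot\nabla\phi)\,dx\,dt=0\qquad\text{for every }\phi\in C_c^\infty([0,T)\times\Omega).$$ -/

import Mathlib

open MeasureTheory Set
open scoped ENNReal ContDiff

/-- The space `ℝ^N` with its Euclidean norm and Lebesgue measure. -/
abbrev Rn (N : ℕ) : Type := EuclideanSpace ℝ (Fin N)

/-- The test functions `C_c^∞(Ω)`. -/
def IsTestFunction {N : ℕ} (Ω : Set (Rn N)) (φ : Rn N → ℝ) : Prop :=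
  ContDiff ℝ ∞ φ ∧ HasCompactSupport φ ∧ tsupport φ ⊆ Ω

/-- The test functions `C_c^∞([0,T) × Ω)`: as functions on `[0,T) × Ω` these are the restrictions
of the smooth functions on `ℝ × ℝ^N` whose support is compact and contained in `(-∞,T) × Ω`.
(They need not vanish at time `0`.) -/
def IsSpaceTimeTestFunction {N : ℕ} (T : ℝ) (Ω : Set (Rn N)) (φ : ℝ × Rn N → ℝ) : Prop :=
  ContDiff ℝ ∞ φ ∧ HasCompactSupport φ ∧ tsupport φ ⊆ Iio T ×ˢ Ω

/-- `f ∈ L^r(0,T;L^p(Ω;F))`: `f` is jointly measurable on `(0,T) × Ω` (up to a null set) and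
`t ↦ ‖f(t,·)‖_{L^p(Ω)}` has finite `L^r(0,T)` norm. -/
def MemLpLp {N : ℕ} {F : Type*} [NormedAddCommGroup F] (T : ℝ) (Ω : Set (Rn N)) (r p : ℝ≥0∞)
    (f : ℝ → Rn N → F) : Prop :=
  AEStronglyMeasurable (fun z : ℝ × Rn N => f z.1 z.2)
      ((volume.restrict (Ioo 0 T)).prod (volume.restrict Ω)) ∧
    eLpNorm (fun t => eLpNorm (f t) p (volume.restrict Ω)) r (volume.restrict (Ioo 0 T)) < ⊤

/-- `V` is the weak (distributional) derivative of the vector field `v` on `Ω`: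
`∫_Ω v ∂_e φ = - ∫_Ω φ (V e)` for all directions `e` and all test functions `φ`. -/
def HasWeakFDerivOn {N : ℕ} (Ω : Set (Rn N)) (v : Rn N → Rn N) (V : Rn N → (Rn N →L[ℝ] Rn N)) :
    Prop :=
  LocallyIntegrableOn v Ω ∧ LocallyIntegrableOn V Ω ∧
    ∀ φ : Rn N → ℝ, IsTestFunction Ω φ → ∀ e : Rn N,
      ∫ x in Ω, (fderiv ℝ φ x e) • v x = - ∫ x in Ω, φ x • V x e

/-- `u ∈ L^1(0,T;W^{1,q}(Ω;ℝ^N))`: `u ∈ L^1(0,T;L^q)` and, for almost every `t`, the field `u(t)`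
has a weak derivative `Du(t)`, with `Du ∈ L^1(0,T;L^q)`. -/
def MemL1W1 {N : ℕ} (T : ℝ) (Ω : Set (Rn N)) (q : ℝ≥0∞) (u : ℝ → Rn N → Rn N) : Prop :=
  MemLpLp T Ω 1 q u ∧
    ∃ Du : ℝ → Rn N → (Rn N →L[ℝ] Rn N), MemLpLp T Ω 1 q Du ∧
      ∀ᵐ t ∂(volume.restrict (Ioo 0 T)), HasWeakFDerivOn Ω (u t) (Du t)

/-- `∇ · v = 0` weakly on `Ω`: `∫_Ω v · ∇φ = 0` for all test functions `φ`
(`fderiv ℝ φ x (v x)` is `v(x) · ∇φ(x)`). -/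
def IsWeaklyDivFree {N : ℕ} (Ω : Set (Rn N)) (v : Rn N → Rn N) : Prop :=
  ∀ φ : Rn N → ℝ, IsTestFunction Ω φ → ∫ x in Ω, fderiv ℝ φ x (v x) = 0

/-- The weak form of `ρ_t - u · ∇ρ = 0` in `(0,T) × Ω`, `ρ(0) = ρ₀`, for divergence-free `u`:
`-∫₀ᵀ∫_Ω ρ φ_t - ∫_Ω ρ₀ φ(0,·) + ∫₀ᵀ∫_Ω ρ u·∇φ = 0` for all `φ ∈ C_c^∞([0,T) × Ω)`. -/
def SatisfiesWeakTransport {N : ℕ} (T : ℝ) (Ω : Set (Rn N)) (u : ℝ → Rn N → Rn N)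
    (ρ₀ : Rn N → ℝ) (ρ : ℝ → Rn N → ℝ) : Prop :=
  ∀ φ : ℝ × Rn N → ℝ, IsSpaceTimeTestFunction T Ω φ →
    -(∫ t in Ioo 0 T, ∫ x in Ω, ρ t x * deriv (fun s => φ (s, x)) t)
      - (∫ x in Ω, ρ₀ x * φ (0, x))
      + (∫ t in Ioo 0 T, ∫ x in Ω, ρ t x * fderiv ℝ (fun y => φ (t, y)) x (u t x)) = 0

/-- `ρ ∈ L^∞(0,T;L^p(Ω))` is a weak solution with velocity `u` and initial density
`ρ₀ ∈ L^p(Ω)`. -/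
structure IsWeakSolution {N : ℕ} (T : ℝ) (Ω : Set (Rn N)) (p : ℝ≥0∞) (u : ℝ → Rn N → Rn N)
    (ρ₀ : Rn N → ℝ) (ρ : ℝ → Rn N → ℝ) : Prop where
  memLp_initial : MemLp ρ₀ p (volume.restrict Ω)
  memLpLp : MemLpLp T Ω ⊤ p ρ
  weak_form : SatisfiesWeakTransport T Ω u ρ₀ ρ

/-- Admissible functions: `β ∈ C^1(ℝ)` with `β` and `β'` bounded. -/
def IsAdmissible (β : ℝ → ℝ) : Prop :=
  ContDiff ℝ 1 β ∧ (∃ C : ℝ, ∀ s, |β s| ≤ C) ∧ (∃ C : ℝ, ∀ s, |deriv β s| ≤ C)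

/-- `ρ ∈ L^∞(0,T;L^p(Ω))` is a renormalized solution with velocity `u` and initial density
`ρ₀ ∈ L^p(Ω)`. -/
structure IsRenormalizedSolution {N : ℕ} (T : ℝ) (Ω : Set (Rn N)) (p : ℝ≥0∞)
    (u : ℝ → Rn N → Rn N) (ρ₀ : Rn N → ℝ) (ρ : ℝ → Rn N → ℝ) : Prop where
  memLp_initial : MemLp ρ₀ p (volume.restrict Ω)
  memLpLp : MemLpLp T Ω ⊤ p ρ
  renormalized : ∀ β : ℝ → ℝ, IsAdmissible β →
    SatisfiesWeakTransport T Ω u (fun x => β (ρ₀ x)) (fun t x => β (ρ t x))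

open Filter Topology

/-! This is the DiPerna–Lions commutator argument, localized away from the boundary of `Ω`. Mollify
in space only: `m = ρ * η`. At a point `x` whose `η`-neighbourhood lies in `Ω`, testing with `ψ(t)
η(x - y)` shows that `t ↦ m(t, x)` is absolutely continuous with derivative the mollified flux `∫
ρ(y) ∇η(x - y) · u(y) dy`. The one-variable chain rule (`weak_chain_rule`) therefore gives an exact
equation for `β(m)`, initial value included. Since `div u = 0`, testing with `φ β(m)` moves the
derivative in `u · ∇β(m)` onto `φ`. What remains is `φ β'(m)` times the commutator `u · ∇m - flux`.

Again by `div u = 0`, the commutator at `x` equals `∫ (ρ(y) - ρ(x)) ∇η(x - y) · (u(x) - u(y)) dy`.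
The difference of `u` is the average of `Du` along a segment, applied to `h = x - y`, and `∫ |∇η(h)|
|h| dh` is bounded independently of the scale of `η`. So the commutator is bounded in `L¹`, up to a
constant, by the oscillation `∫ |ρ(y + h) - ρ(y)| |Du(y)| dy` over small `h`
(`lintegral_commutator_le`).

This oscillation tends to zero even for `p = ∞`, where translations are not continuous in `L^p`: as
`q < ∞`, `Du` is close in `L^q` to a bounded function, and against a bounded function
`L¹`-continuity of translations suffices (`tendsto_lintegral_translate_sub_mul`). Hölder dominates
it by `2 ‖ρ(t)‖_p ‖Du(t)‖_q`, integrable in time, so the defect vanishes in the limit. This settles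
smooth `β`; a final regularization of `β` reaches `C¹`. -/

/-! ### Absolutely continuous functions of time and their chain rule. -/

theorem AbsolutelyContinuousOnInterval.lipschitzWith_comp {f β : ℝ → ℝ} {a b : ℝ} {K : NNReal}
    (hβ : LipschitzWith K β) (hf : AbsolutelyContinuousOnInterval f a b) :
    AbsolutelyContinuousOnInterval (fun t => β (f t)) a b := by
  unfold AbsolutelyContinuousOnInterval at hf ⊢
  have h := hf.const_mul (K : ℝ)
  rw [mul_zero] at h
  refine squeeze_zero (fun _ => Finset.sum_nonneg fun _ _ => dist_nonneg) (fun I => ?_) h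
  rw [Finset.mul_sum]
  exact Finset.sum_le_sum fun i _ => hβ.dist_le_mul _ _

/-- Integration by parts for `β ∘ F`, where `F` is a primitive of an integrable function. -/
theorem integral_deriv_mul_comp_primitive {T a : ℝ} (hT : 0 < T) {g β ψ : ℝ → ℝ} {K : NNReal}
    (hg : IntegrableOn g (Ioo 0 T)) (hβ : ContDiff ℝ 1 β) (hβK : LipschitzWith K β)
    (hψ : ContDiff ℝ 1 ψ) (hψT : ψ T = 0) :
    (∫ t in Ioo 0 T, deriv ψ t * β (a + ∫ s in (0 : ℝ)..t, g s)) + ψ 0 * β a +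
      ∫ t in Ioo 0 T, ψ t * (deriv β (a + ∫ s in (0 : ℝ)..t, g s) * g t) = 0 := by
  have hgi : IntervalIntegrable g volume 0 T := by
    rw [intervalIntegrable_iff, uIoc_of_le hT.le]
    exact (integrableOn_Ioc_iff_integrableOn_Ioo).2 hg
  set F : ℝ → ℝ := fun t => a + ∫ s in (0 : ℝ)..t, g s with hF
  have hFac : AbsolutelyContinuousOnInterval F 0 T := by
    have h0 : AbsolutelyContinuousOnInterval (fun _ : ℝ => a) 0 T :=
      (contDiff_const.contDiffOn (n := 1)).absolutelyContinuousOnInterval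
    exact h0.add (hgi.absolutelyContinuousOnInterval_intervalIntegral (by simp))
  -- `F` is differentiable only almost everywhere, but `β ∘ F` stays absolutely continuous, which is
  -- all that integration by parts needs.
  have hac := hFac.lipschitzWith_comp hβK
  have hψac : AbsolutelyContinuousOnInterval ψ 0 T :=
    hψ.contDiffOn.absolutelyContinuousOnInterval
  have key := hψac.integral_mul_deriv_eq_deriv_mul hac
  have hd : ∫ t in (0 : ℝ)..T, ψ t * deriv (fun t => β (F t)) t =
      ∫ t in (0 : ℝ)..T, ψ t * (deriv β (F t) * g t) := by
    apply intervalIntegral.integral_congr_ae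
    filter_upwards [hgi.ae_hasDerivAt_integral] with x hx hx'
    have hx1 := hx (uIoc_subset_uIcc hx') 0 (by simp)
    have hβx := (hβ.differentiable one_ne_zero (F x)).hasDerivAt
    have hc : HasDerivAt (fun t => β (F t)) (deriv β (F x) * g x) x :=
      hβx.comp x (hx1.const_add a)
    rw [hc.deriv]
  rw [hd, intervalIntegral.integral_of_le hT.le, intervalIntegral.integral_of_le hT.le,
    integral_Ioc_eq_integral_Ioo, integral_Ioc_eq_integral_Ioo, hψT] at key
  have hF0 : F 0 = a := by simp [hF]
  simp only [hF0] at key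
  rw [key]
  ring

/-- A function with integrable weak derivative `g` and initial value `a` is `a + ∫₀ᵗ g`. -/
theorem ae_eq_primitive_of_weak {T a : ℝ} (hT : 0 < T) {f g : ℝ → ℝ}
    (hf : IntegrableOn f (Ioo 0 T)) (hg : IntegrableOn g (Ioo 0 T))
    (h : ∀ ψ : ℝ → ℝ, ContDiff ℝ ∞ ψ → HasCompactSupport ψ → tsupport ψ ⊆ Iio T →
      (∫ t in Ioo 0 T, deriv ψ t * f t) + ψ 0 * a + ∫ t in Ioo 0 T, ψ t * g t = 0) :
    ∀ᵐ t ∂(volume.restrict (Ioo 0 T)), f t = a + ∫ s in (0 : ℝ)..t, g s := by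
  set F : ℝ → ℝ := fun t => a + ∫ s in (0 : ℝ)..t, g s with hF
  have hgi : IntegrableOn g (Icc 0 T) := (integrableOn_Icc_iff_integrableOn_Ioo).2 hg
  have hFc : ContinuousOn F (Icc 0 T) := by
    refine continuousOn_const.add ?_
    have := intervalIntegral.continuousOn_primitive_interval (f := g) (μ := volume) (a := 0)
      (b := T) (by rwa [uIcc_of_le hT.le])
    rwa [uIcc_of_le hT.le] at this
  have hFi : IntegrableOn F (Ioo 0 T) :=
    (hFc.integrableOn_compact isCompact_Icc).mono_set Ioo_subset_Icc_self
  have hfF : IntegrableOn (fun t => f t - F t) (Ioo 0 T) := hf.sub hFi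
  rw [ae_restrict_iff' measurableSet_Ioo]
  suffices hs : ∀ᵐ t, t ∈ Ioo 0 T → f t - F t = 0 by
    filter_upwards [hs] with t ht ht'
    exact sub_eq_zero.1 (ht ht')
  refine isOpen_Ioo.ae_eq_zero_of_integral_contDiff_smul_eq_zero hfF.locallyIntegrableOn ?_
  intro χ hχ hχc hχs
  -- A time strictly before `T` after which `χ` vanishes. The antiderivative of `χ` based at `T`
  -- then also vanishes from `b` on, so its support stays below `T`.
  obtain ⟨b, hb0, hbT, hb⟩ : ∃ b, 0 < b ∧ b < T ∧ ∀ t, b ≤ t → χ t = 0 := by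
    rcases (tsupport χ).eq_empty_or_nonempty with he | hne
    · refine ⟨T / 2, by linarith, by linarith, fun t _ => ?_⟩
      exact image_eq_zero_of_notMem_tsupport (by simp [he])
    · have hm := hχs (hχc.isCompact.sSup_mem hne)
      refine ⟨(sSup (tsupport χ) + T) / 2, by linarith [hm.1, hm.2], by linarith [hm.2],
        fun t ht => ?_⟩
      refine image_eq_zero_of_notMem_tsupport fun hmem => ?_
      have := le_csSup hχc.isCompact.bddAbove hmem
      linarith [hm.2]
  have hΨd : ∀ t, HasDerivAt (fun t => ∫ s in T..t, χ s) (χ t) t := fun t =>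
    intervalIntegral.integral_hasDerivAt_right (hχ.continuous.intervalIntegrable _ _)
      (hχ.continuous.stronglyMeasurableAtFilter _ _) hχ.continuous.continuousAt
  set Ψ : ℝ → ℝ := fun t => ∫ s in T..t, χ s with hΨ
  have hΨsm : ContDiff ℝ ∞ Ψ := by
    rw [contDiff_infty_iff_deriv]
    refine ⟨fun t => (hΨd t).differentiableAt, ?_⟩
    rwa [show deriv Ψ = χ from funext fun t => (hΨd t).deriv]
  have hΨ0 : ∀ t, b ≤ t → Ψ t = 0 := by
    intro t ht
    rw [hΨ]
    refine intervalIntegral.integral_zero_ae (ae_of_all _ fun s hs => hb s ?_)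
    rcases le_total T t with h1 | h1
    · rw [uIoc_of_le h1] at hs; linarith [hs.1]
    · rw [uIoc_of_ge h1] at hs; linarith [hs.1]
  -- For negative times `Ψ` is constant and possibly nonzero. The cutoff makes its support compact
  -- without changing it near `[0, T]`.
  let κ : ContDiffBump (0 : ℝ) := ⟨T + 1, T + 2, by linarith, by linarith⟩
  set ψ : ℝ → ℝ := fun t => κ t * Ψ t with hψ
  have hψsm : ContDiff ℝ ∞ ψ := κ.contDiff.mul hΨsm
  have hψc : HasCompactSupport ψ := κ.hasCompactSupport.mul_right
  have hψs : tsupport ψ ⊆ Iio T := by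
    have : tsupport ψ ⊆ Iic b := by
      refine closure_minimal (fun t ht => ?_) isClosed_Iic
      by_contra hc
      exact ht (by simp [hψ, hΨ0 t (not_le.1 hc).le])
    exact this.trans fun t ht => lt_of_le_of_lt ht hbT
  have hψeq : ∀ t ∈ Ioo (-1) (T + 1), ψ =ᶠ[nhds t] Ψ := by
    intro t ht
    have : t ∈ Metric.ball (0 : ℝ) κ.rIn := by
      simp only [Metric.mem_ball, dist_zero_right, Real.norm_eq_abs, abs_lt]
      exact ⟨by have := ht.1; change -(T + 1) < t; linarith, ht.2⟩
    filter_upwards [κ.eventuallyEq_one_of_mem_ball this] with s hs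
    simp [hψ, hs]
  have hder : ∀ t ∈ Ioo 0 T, deriv ψ t = χ t := by
    intro t ht
    rw [(hψeq t ⟨by linarith [ht.1], by linarith [ht.2]⟩).deriv_eq, (hΨd t).deriv]
  have e1 := h ψ hψsm hψc hψs
  -- For `β = id` this is the weak identity for `F`, with the same `a` and `g` as for `f`.
  -- Subtracting the two leaves `∫ χ (f - F) = 0`.
  have e2 := integral_deriv_mul_comp_primitive (a := a) (β := id) (ψ := ψ) (K := 1) hT hg
    contDiff_id LipschitzWith.id (hψsm.of_le (by exact_mod_cast le_top))
    (by simp [hψ, hΨ0 T hbT.le])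
  simp only [id_eq, deriv_id, one_mul] at e2
  have hdi : ∀ {k : ℝ → ℝ}, IntegrableOn k (Ioo 0 T) →
      IntegrableOn (fun t => deriv ψ t * k t) (Ioo 0 T) := by
    intro k hk
    obtain ⟨C, hC⟩ := (hχ.continuous.bounded_above_of_compact_support hχc)
    have : IntegrableOn (fun t => χ t * k t) (Ioo 0 T) :=
      hk.bdd_mul hχ.continuous.aestronglyMeasurable (ae_of_all _ hC)
    exact this.congr_fun (fun t ht => by simp [hder t ht]) measurableSet_Ioo
  have e3 : ∫ t in Ioo 0 T, χ t • (f t - F t) =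
      (∫ t in Ioo 0 T, deriv ψ t * f t) - ∫ t in Ioo 0 T, deriv ψ t * F t := by
    rw [← integral_sub (hdi hf) (hdi hFi)]
    refine setIntegral_congr_fun measurableSet_Ioo fun t ht => ?_
    simp only [smul_eq_mul, hder t ht]
    ring
  have e4 : ∫ t, χ t • (f t - F t) = ∫ t in Ioo 0 T, χ t • (f t - F t) := by
    refine (setIntegral_eq_integral_of_forall_compl_eq_zero fun t ht => ?_).symm
    rw [image_eq_zero_of_notMem_tsupport (fun hc => ht (hχs hc)), zero_smul]
  rw [e4, e3]
  linarith

/-- The chain rule for weakly differentiable functions of one variable with an initial value. -/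
theorem weak_chain_rule {T a : ℝ} (hT : 0 < T) {f g β : ℝ → ℝ} {K : NNReal}
    (hf : IntegrableOn f (Ioo 0 T)) (hg : IntegrableOn g (Ioo 0 T))
    (h : ∀ ψ : ℝ → ℝ, ContDiff ℝ ∞ ψ → HasCompactSupport ψ → tsupport ψ ⊆ Iio T →
      (∫ t in Ioo 0 T, deriv ψ t * f t) + ψ 0 * a + ∫ t in Ioo 0 T, ψ t * g t = 0)
    (hβ : ContDiff ℝ 1 β) (hβK : LipschitzWith K β)
    {ψ : ℝ → ℝ} (hψ : ContDiff ℝ 1 ψ) (hψT : ψ T = 0) :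
    (∫ t in Ioo 0 T, deriv ψ t * β (f t)) + ψ 0 * β a +
      ∫ t in Ioo 0 T, ψ t * (deriv β (f t) * g t) = 0 := by
  have hae := ae_eq_primitive_of_weak hT hf hg h
  have e1 : ∫ t in Ioo 0 T, deriv ψ t * β (f t) =
      ∫ t in Ioo 0 T, deriv ψ t * β (a + ∫ s in (0 : ℝ)..t, g s) := by
    refine integral_congr_ae ?_
    filter_upwards [hae] with t ht
    rw [ht]
  have e2 : ∫ t in Ioo 0 T, ψ t * (deriv β (f t) * g t) =
      ∫ t in Ioo 0 T, ψ t * (deriv β (a + ∫ s in (0 : ℝ)..t, g s) * g t) := by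
    refine integral_congr_ae ?_
    filter_upwards [hae] with t ht
    rw [ht]
  rw [e1, e2]
  exact integral_deriv_mul_comp_primitive hT hg hβ hβK hψ hψT

/-! ### Scale-invariant bound for the gradient of a mollifier. -/

section Mollifier

variable {N : ℕ}

/-- Standard mollifiers: the weighted `L¹` norm `∫ |Dη(h)| |h| dh` does not depend on the scale. -/
theorem exists_lintegral_fderiv_normed_le (N : ℕ) : ∃ C : ℝ≥0∞, C ≠ ⊤ ∧
    ∀ φ : ContDiffBump (0 : Rn N), φ.rOut = 2 * φ.rIn →
      ∫⁻ h, ‖fderiv ℝ (φ.normed (volume : Measure (Rn N))) h‖ₑ * ‖h‖ₑ ≤ C := by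
  -- The profile of a bump depends only on the ratio of its radii, so every `φ` considered is a
  -- rescaling of `B`.
  let B : ContDiffBump (0 : Rn N) := ⟨1, 2, one_pos, one_lt_two⟩
  obtain ⟨C₀, hC₀⟩ := (B.contDiff.continuous_fderiv (n := 1)
    one_ne_zero).bounded_above_of_compact_support (B.hasCompactSupport.fderiv (𝕜 := ℝ))
  have hC₀0 : 0 ≤ C₀ := (norm_nonneg _).trans (hC₀ 0)
  refine ⟨ENNReal.ofReal (C₀ * 2 * 2 ^ Module.finrank ℝ (Rn N)), ENNReal.ofReal_ne_top,
    fun φ hφ => ?_⟩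
  have hr := φ.rIn_pos
  set I := ∫ x, φ x with hI
  have hIpos : 0 < I := φ.integral_pos
  have hφB : ∀ x, φ.normed volume x = I⁻¹ * B (φ.rIn⁻¹ • x) := by
    intro x
    rw [ContDiffBump.normed_def, div_eq_inv_mul, φ.apply, B.apply, hφ,
      mul_div_cancel_right₀ _ hr.ne']
    rw [← hI]
    simp [B]
  have hder : ∀ h, ‖fderiv ℝ (φ.normed (volume : Measure (Rn N))) h‖ ≤ I⁻¹ * (C₀ * φ.rIn⁻¹) := by
    intro h
    have h1 : φ.normed (volume : Measure (Rn N)) = fun x => I⁻¹ • B (φ.rIn⁻¹ • x) :=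
      funext fun x => by rw [hφB, smul_eq_mul]
    have h2 : DifferentiableAt ℝ (fun x => B (φ.rIn⁻¹ • x)) h :=
      ((B.contDiff (n := 1)).comp (contDiff_const_smul φ.rIn⁻¹)).differentiable one_ne_zero h
    rw [h1, fderiv_fun_const_smul h2, norm_smul, fderiv_comp_smul, norm_smul,
      Real.norm_of_nonneg (inv_nonneg.2 hIpos.le), Real.norm_of_nonneg (inv_nonneg.2 hr.le),
      mul_comm C₀]
    have := hC₀ (φ.rIn⁻¹ • h)
    gcongr
  have hpt : ∀ h, ‖fderiv ℝ (φ.normed (volume : Measure (Rn N))) h‖ₑ * ‖h‖ₑ ≤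
      (Metric.closedBall (0 : Rn N) φ.rOut).indicator
        (fun _ => ENNReal.ofReal (I⁻¹ * (C₀ * 2))) h := by
    intro h
    by_cases hh : h ∈ Metric.closedBall (0 : Rn N) φ.rOut
    · rw [indicator_of_mem hh, ← ofReal_norm, ← ofReal_norm,
        ← ENNReal.ofReal_mul (norm_nonneg _)]
      apply ENNReal.ofReal_le_ofReal
      -- On the support, `‖h‖` compensates the factor `rIn⁻¹` produced by differentiating the
      -- rescaled profile.
      have hh' : ‖h‖ ≤ 2 * φ.rIn := by rw [← hφ]; simpa using hh
      calc _ ≤ (I⁻¹ * (C₀ * φ.rIn⁻¹)) * (2 * φ.rIn) := by gcongr; exact hder h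
        _ = _ := by field_simp
    · have : fderiv ℝ (φ.normed (volume : Measure (Rn N))) h = 0 := by
        refine image_eq_zero_of_notMem_tsupport fun hc => hh ?_
        have := tsupport_fderiv_subset ℝ hc
        rwa [φ.tsupport_normed_eq] at this
      rw [← ofReal_norm (fderiv ℝ _ h), this, norm_zero, ENNReal.ofReal_zero, zero_mul]
      exact zero_le
  calc _ ≤ ∫⁻ h, (Metric.closedBall (0 : Rn N) φ.rOut).indicator
        (fun _ => ENNReal.ofReal (I⁻¹ * (C₀ * 2))) h := lintegral_mono hpt
    _ = ENNReal.ofReal (I⁻¹ * (C₀ * 2)) * volume (Metric.closedBall (0 : Rn N) φ.rOut) := by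
        rw [lintegral_indicator Metric.isClosed_closedBall.measurableSet, setLIntegral_const]
    _ = ENNReal.ofReal (I⁻¹ * (C₀ * 2) * volume.real (Metric.closedBall (0 : Rn N) φ.rOut)) := by
        rw [ENNReal.ofReal_mul (p := I⁻¹ * (C₀ * 2)) (by positivity), measureReal_def,
          ENNReal.ofReal_toReal measure_closedBall_lt_top.ne]
    _ ≤ _ := by
        apply ENNReal.ofReal_le_ofReal
        -- The ball has volume at most `2 ^ N * I`, which cancels the normalization `I⁻¹`.
        have := φ.measure_closedBall_div_le_integral volume 2 hφ.le
        rw [div_le_iff₀ (by positivity)] at this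
        calc _ ≤ I⁻¹ * (C₀ * 2) * (I * 2 ^ Module.finrank ℝ (Rn N)) := by gcongr
          _ = _ := by field_simp

end Mollifier

/-! ### Oscillation of the density under translations. -/

section Translation

variable {N : ℕ} {F : Type*} [NormedAddCommGroup F]

/-- Translations are continuous in `L¹`. -/
theorem tendsto_lintegral_translate_sub {ρ : Rn N → ℝ} (hρ : Integrable ρ) :
    Tendsto (fun h : Rn N => ∫⁻ y, ‖ρ (y + h) - ρ y‖ₑ) (𝓝 0) (𝓝 0) := by
  let g : Rn N → C(Rn N, Rn N) := fun h => ⟨fun y => y + h, by fun_prop⟩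
  have hg : Continuous g :=
    ContinuousMap.continuous_of_continuous_uncurry _ (by dsimp [g, Function.uncurry]; fun_prop)
  have hm : ∀ h, MeasurePreserving (g h) (volume : Measure (Rn N)) volume := fun h =>
    measurePreserving_add_right volume h
  have hρ1 : MemLp ρ 1 (volume : Measure (Rn N)) := memLp_one_iff_integrable.2 hρ
  have key := Filter.Tendsto.compMeasurePreservingLp (p := 1)
    (tendsto_const_nhds (x := hρ1.toLp ρ) (f := 𝓝 (0 : Rn N))) (hg.tendsto 0) hm (hm 0)
    ENNReal.one_ne_top
  rw [tendsto_iff_edist_tendsto_0] at key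
  refine key.congr fun h => ?_
  rw [Lp.edist_def, eLpNorm_one_eq_lintegral_enorm]
  refine lintegral_congr_ae ?_
  have e1 := Lp.coeFn_compMeasurePreserving (hρ1.toLp ρ) (hm h)
  have e2 := Lp.coeFn_compMeasurePreserving (hρ1.toLp ρ) (hm 0)
  have e3 := (hm h).quasiMeasurePreserving.ae_eq_comp hρ1.coeFn_toLp
  have e4 := (hm 0).quasiMeasurePreserving.ae_eq_comp hρ1.coeFn_toLp
  filter_upwards [e1, e2, e3, e4] with y h1 h2 h3 h4
  rw [Pi.sub_apply, h1, h2, h3, h4]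
  simp [g]

/-- Hölder's inequality for lower Lebesgue integrals of norms. -/
theorem lintegral_enorm_mul_enorm_le {p q : ℝ≥0∞} (hpq : p.HolderConjugate q)
    {F' : Type*} [NormedAddCommGroup F'] {f : Rn N → F'} {V : Rn N → F}
    (hf : AEStronglyMeasurable f) (hV : AEStronglyMeasurable V) :
    ∫⁻ y, ‖f y‖ₑ * ‖V y‖ₑ ≤ eLpNorm f p volume * eLpNorm V q volume := by
  have : ENNReal.HolderTriple p q 1 := hpq
  have h := eLpNorm_smul_le_mul_eLpNorm (p := p) (q := q) (r := 1) hV.norm hf.norm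
  rw [eLpNorm_norm, eLpNorm_norm, eLpNorm_one_eq_lintegral_enorm] at h
  simpa [enorm_mul] using h

theorem eLpNorm_translate_sub_le {p : ℝ≥0∞} (hp : 1 ≤ p) {ρ : Rn N → ℝ}
    (hρ : AEStronglyMeasurable ρ) (h : Rn N) :
    eLpNorm (fun y => ρ (y + h) - ρ y) p volume ≤ 2 * eLpNorm ρ p volume := by
  have hm := measurePreserving_add_right (volume : Measure (Rn N)) h
  have h1 : AEStronglyMeasurable (fun y => ρ (y + h)) volume :=
    hρ.comp_quasiMeasurePreserving hm.quasiMeasurePreserving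
  refine (eLpNorm_sub_le h1 hρ hp).trans_eq ?_
  rw [show (fun y => ρ (y + h)) = ρ ∘ (fun y => y + h) from rfl,
    eLpNorm_comp_measurePreserving hρ hm, two_mul]

/-- Uniformity in `h` is the point: the bound absorbs the approximation error in `V` below, and
later dominates the defect in time. -/
theorem lintegral_translate_sub_mul_le {p q : ℝ≥0∞} (hp : 1 ≤ p) (hpq : p.HolderConjugate q)
    {ρ : Rn N → ℝ} {V : Rn N → F} (hρ : AEStronglyMeasurable ρ) (hV : AEStronglyMeasurable V)
    (h : Rn N) :
    ∫⁻ y, ‖ρ (y + h) - ρ y‖ₑ * ‖V y‖ₑ ≤ 2 * eLpNorm ρ p volume * eLpNorm V q volume := by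
  have hm := measurePreserving_add_right (volume : Measure (Rn N)) h
  have h1 : AEStronglyMeasurable (fun y => ρ (y + h)) volume :=
    hρ.comp_quasiMeasurePreserving hm.quasiMeasurePreserving
  refine (lintegral_enorm_mul_enorm_le hpq (h1.sub hρ) hV).trans ?_
  gcongr
  exact eLpNorm_translate_sub_le hp hρ h

/-- For `ρ ∈ L¹ ∩ L^p` and `V ∈ L^q`, `q < ∞`, the oscillation `∫ |ρ(y+h) - ρ(y)| |V(y)| dy` tends
to zero as `h → 0`, even for `p = ∞`. -/
theorem tendsto_lintegral_translate_sub_mul {p q : ℝ≥0∞} (hp : 1 ≤ p) (hq : q ≠ ⊤)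
    (hpq : p.HolderConjugate q) {ρ : Rn N → ℝ} {V : Rn N → F}
    (hρ : Integrable ρ) (hρp : eLpNorm ρ p volume ≠ ⊤) (hV : MemLp V q) :
    Tendsto (fun h : Rn N => ∫⁻ y, ‖ρ (y + h) - ρ y‖ₑ * ‖V y‖ₑ) (𝓝 0) (𝓝 0) := by
  rw [ENNReal.tendsto_nhds_zero]
  intro ε hε
  rcases eq_or_ne ε ⊤ with rfl | hεt
  · simp
  set M := eLpNorm ρ p (volume : Measure (Rn N)) with hM
  -- The tolerance makes the Hölder error `2 * M * δ` at most `ε / 2`; the `+ 1` covers `M = 0`.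
  have hδ : ε / 2 / (2 * M + 1) ≠ 0 := by
    refine (ENNReal.div_pos (ENNReal.half_pos hε.ne').ne' ?_).ne'
    exact ENNReal.add_ne_top.2 ⟨ENNReal.mul_ne_top (by simp) hρp, by simp⟩
  -- Here `q < ∞` is essential. The remainder `V - g` is handled by Hölder uniformly in `h`, the
  -- bounded part `g` by continuity of translations in `L¹`.
  obtain ⟨g, hg, hgq⟩ := hV.exists_simpleFunc_eLpNorm_sub_lt hq hδ
  obtain ⟨C, hC⟩ := g.exists_forall_norm_le
  have hC' : ∀ y, ‖g y‖ₑ ≤ ENNReal.ofReal C := fun y => by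
    rw [← ofReal_norm]; exact ENNReal.ofReal_le_ofReal (hC y)
  have h0 := ENNReal.Tendsto.const_mul (a := ENNReal.ofReal C)
    (tendsto_lintegral_translate_sub hρ) (Or.inr ENNReal.ofReal_ne_top)
  rw [mul_zero, ENNReal.tendsto_nhds_zero] at h0
  filter_upwards [h0 _ (ENNReal.half_pos hε.ne')] with h hh
  have hm := measurePreserving_add_right (volume : Measure (Rn N)) h
  have h1 : AEStronglyMeasurable (fun y => ρ (y + h)) volume :=
    hρ.1.comp_quasiMeasurePreserving hm.quasiMeasurePreserving
  have hd : AEMeasurable (fun y => ‖ρ (y + h) - ρ y‖ₑ) volume := (h1.sub hρ.1).enorm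
  calc ∫⁻ y, ‖ρ (y + h) - ρ y‖ₑ * ‖V y‖ₑ
      ≤ ∫⁻ y, (‖ρ (y + h) - ρ y‖ₑ * ‖(V - g) y‖ₑ +
          ENNReal.ofReal C * ‖ρ (y + h) - ρ y‖ₑ) := by
        refine lintegral_mono fun y => ?_
        rw [mul_comm (ENNReal.ofReal C), ← mul_add]
        gcongr
        calc ‖V y‖ₑ = ‖(V - g) y + g y‖ₑ := by simp
          _ ≤ ‖(V - g) y‖ₑ + ‖g y‖ₑ := enorm_add_le _ _
          _ ≤ _ := by gcongr; exact hC' y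
    _ = (∫⁻ y, ‖ρ (y + h) - ρ y‖ₑ * ‖(V - g) y‖ₑ) +
          ENNReal.ofReal C * ∫⁻ y, ‖ρ (y + h) - ρ y‖ₑ := by
        rw [lintegral_add_right' _ (hd.const_mul _), lintegral_const_mul'' _ hd]
    _ ≤ 2 * M * (ε / 2 / (2 * M + 1)) + ε / 2 := by
        gcongr
        refine (lintegral_translate_sub_mul_le hp hpq hρ.1 (hV.sub hgq).1 h).trans ?_
        gcongr
    _ ≤ (2 * M + 1) * (ε / 2 / (2 * M + 1)) + ε / 2 := by gcongr; exact le_self_add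
    _ ≤ ε / 2 + ε / 2 := by gcongr; exact ENNReal.mul_div_le
    _ = ε := ENNReal.add_halves ε

end Translation

/-! ### Differences of Sobolev fields along segments. -/

section DifferenceQuotient

variable {N : ℕ}

/-- The difference of a Sobolev field and its translate is the average of the directional weak
derivative along the segment. -/
theorem HasWeakFDerivOn.ae_sub_translate_eq {Ω U : Set (Rn N)} (hU : IsOpen U)
    {v : Rn N → Rn N} {V : Rn N → (Rn N →L[ℝ] Rn N)} (hvV : HasWeakFDerivOn Ω v V)
    (hv : Integrable v) (hV : Integrable V) (hVm : StronglyMeasurable V)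
    (hv0 : ∀ x ∉ Ω, v x = 0) (hV0 : ∀ x ∉ Ω, V x = 0) {h : Rn N}
    (hUΩ : ∀ x ∈ U, ∀ s ∈ Icc (0 : ℝ) 1, x - s • h ∈ Ω) :
    ∀ᵐ x, x ∈ U → v x - v (x - h) = ∫ s in Ioo (0 : ℝ) 1, V (x - s • h) h := by
  have hVh : Integrable (fun x => V x h) :=
    (ContinuousLinearMap.apply ℝ (Rn N) h).integrable_comp hV
  have hprod : Integrable (fun z : Rn N × ℝ => V (z.1 - z.2 • h) h)
      ((volume : Measure (Rn N)).prod (volume.restrict (Ioo (0 : ℝ) 1))) := by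
    have hm : StronglyMeasurable (fun z : Rn N × ℝ => V (z.1 - z.2 • h) h) :=
      (ContinuousLinearMap.apply ℝ (Rn N) h).continuous.comp_stronglyMeasurable
        (hVm.comp_measurable (by fun_prop : Measurable fun z : Rn N × ℝ => z.1 - z.2 • h))
    rw [integrable_prod_iff' hm.aestronglyMeasurable]
    refine ⟨ae_of_all _ fun s => hVh.comp_sub_right (s • h), ?_⟩
    have : ∀ s : ℝ, ∫ x, ‖V (x - s • h) h‖ = ∫ x, ‖V x h‖ := fun s =>
      integral_sub_right_eq_self (fun x => ‖V x h‖) (s • h)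
    simp only [this]
    exact integrable_const _
  have hI : Integrable (fun x => ∫ s in Ioo (0 : ℝ) 1, V (x - s • h) h) := hprod.integral_prod_left
  have hvt : Integrable (fun x => v (x - h)) := hv.comp_sub_right h
  suffices hs : ∀ᵐ x, x ∈ U →
      v x - v (x - h) - ∫ s in Ioo (0 : ℝ) 1, V (x - s • h) h = 0 by
    filter_upwards [hs] with x hx hxU
    exact sub_eq_zero.1 (hx hxU)
  -- The formula is proved by duality: every translation is moved onto `φ`, where the fundamental
  -- theorem of calculus applies classically.
  refine hU.ae_eq_zero_of_integral_contDiff_smul_eq_zero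
    (((hv.sub hvt).sub hI).locallyIntegrable.locallyIntegrableOn U) fun φ hφ hφc hφU => ?_
  obtain ⟨C, hC⟩ := hφ.continuous.bounded_above_of_compact_support hφc
  obtain ⟨C', hC'⟩ := (hφ.continuous_fderiv (by simp)).bounded_above_of_compact_support
    (hφc.fderiv (𝕜 := ℝ))
  have bdd : ∀ {f : Rn N → Rn N}, Integrable f → Integrable (fun x => φ x • f x) := fun hf =>
    hf.bdd_smul C hφ.continuous.aestronglyMeasurable (ae_of_all _ hC)
  have e1 : ∫ x, φ x • v (x - h) = ∫ x, φ (x + h) • v x := by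
    rw [← integral_add_right_eq_self _ h]
    simp
  have e2 : ∫ x, φ x • ∫ s in Ioo (0 : ℝ) 1, V (x - s • h) h =
      ∫ s in Ioo (0 : ℝ) 1, ∫ x, φ x • V (x - s • h) h := by
    simp_rw [← integral_smul]
    refine integral_integral_swap ?_
    exact hprod.bdd_smul C
      (hφ.continuous.comp continuous_fst).aestronglyMeasurable (ae_of_all _ fun z => hC z.1)
  have e3 : ∀ s ∈ Ioo (0 : ℝ) 1, ∫ x, φ x • V (x - s • h) h =
      - ∫ x, fderiv ℝ φ (x + s • h) h • v x := by
    intro s hs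
    have e : ∫ x, φ x • V (x - s • h) h = ∫ x, φ (x + s • h) • V x h := by
      rw [← integral_add_right_eq_self _ (s • h)]
      simp
    -- The segment condition `hUΩ` keeps the translated support inside `Ω`, so the weak derivative
    -- may be tested with it.
    have htest : IsTestFunction Ω (fun x => φ (x + s • h)) := by
      refine ⟨hφ.comp (contDiff_id.add contDiff_const),
        hφc.comp_homeomorph (Homeomorph.addRight (s • h)), ?_⟩
      refine (tsupport_comp_subset_preimage φ (by fun_prop)).trans fun x hx => ?_
      have := hUΩ _ (hφU hx) s ⟨hs.1.le, hs.2.le⟩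
      simpa using this
    have key := hvV.2.2 _ htest h
    rw [setIntegral_eq_integral_of_forall_compl_eq_zero fun x hx => by simp [hv0 x hx],
      setIntegral_eq_integral_of_forall_compl_eq_zero fun x hx => by simp [hV0 x hx]] at key
    simp only [fderiv_comp_add_right] at key
    rw [e, key, neg_neg]
  have e4 : ∫ s in Ioo (0 : ℝ) 1, ∫ x, fderiv ℝ φ (x + s • h) h • v x =
      ∫ x, (∫ s in Ioo (0 : ℝ) 1, fderiv ℝ φ (x + s • h) h) • v x := by
    simp_rw [← integral_smul_const]
    refine integral_integral_swap ?_
    have hv2 : Integrable (fun z : ℝ × Rn N => v z.2)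
        ((volume.restrict (Ioo (0 : ℝ) 1)).prod (volume : Measure (Rn N))) := hv.comp_snd _
    refine hv2.bdd_smul (φ := fun z : ℝ × Rn N => fderiv ℝ φ (z.2 + z.1 • h) h) (C' * ‖h‖) ?_
      (ae_of_all _ fun z => ?_)
    · have hc := hφ.continuous_fderiv (by simp)
      exact Continuous.aestronglyMeasurable (by fun_prop)
    · exact (ContinuousLinearMap.le_opNorm _ _).trans
        (mul_le_mul_of_nonneg_right (hC' _) (norm_nonneg _))
  have e5 : ∀ x, ∫ s in Ioo (0 : ℝ) 1, fderiv ℝ φ (x + s • h) h = φ (x + h) - φ x := by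
    intro x
    have hd : ∀ s ∈ uIcc (0 : ℝ) 1,
        HasDerivAt (fun s : ℝ => φ (x + s • h)) (fderiv ℝ φ (x + s • h) h) s := by
      intro s _
      have h1 : HasDerivAt (fun s : ℝ => x + s • h) h s := by
        simpa using ((hasDerivAt_id s).smul_const h).const_add x
      exact ((hφ.differentiable (by simp) _).hasFDerivAt).comp_hasDerivAt s h1
    have hc : Continuous fun s : ℝ => fderiv ℝ φ (x + s • h) h := by
      have hc := hφ.continuous_fderiv (by simp)
      fun_prop
    have := intervalIntegral.integral_eq_sub_of_hasDerivAt hd (hc.intervalIntegrable _ _)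
    rw [intervalIntegral.integral_of_le zero_le_one, integral_Ioc_eq_integral_Ioo] at this
    simpa using this
  have e6 : ∫ x, φ x • ∫ s in Ioo (0 : ℝ) 1, V (x - s • h) h =
      -∫ x, (φ (x + h) - φ x) • v x := by
    rw [e2, setIntegral_congr_fun measurableSet_Ioo e3, integral_neg, e4]
    simp only [e5]
  have hφh : Integrable (fun x => φ (x + h) • v x) :=
    hv.bdd_smul C (hφ.continuous.comp (continuous_add_const h)).aestronglyMeasurable
      (ae_of_all _ fun x => hC _)
  simp_rw [smul_sub]
  have b1 : Integrable (fun x => φ x • v x - φ x • v (x - h)) := (bdd hv).sub (bdd hvt)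
  rw [integral_sub b1 (bdd hI), integral_sub (bdd hv) (bdd hvt), e1, e6]
  simp_rw [sub_smul]
  rw [integral_sub hφh (bdd hv)]
  abel

end DifferenceQuotient

/-! ### The commutator estimate. -/

section Commutator

variable {N : ℕ}

/-- The `L¹` estimate for the commutator of mollification and transport by a Sobolev field: it is
controlled by the oscillation of `ρ` against the gradient of the field. -/
theorem lintegral_commutator_le {Ω U : Set (Rn N)} (hU : IsOpen U) {ρ : Rn N → ℝ}
    {v : Rn N → Rn N} {V : Rn N → (Rn N →L[ℝ] Rn N)} {η : Rn N → ℝ} {r : ℝ} {A : ℝ≥0∞}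
    (hvV : HasWeakFDerivOn Ω v V) (hv : Integrable v) (hV : Integrable V)
    (hρm : StronglyMeasurable ρ) (hvm : StronglyMeasurable v) (hVm : StronglyMeasurable V)
    (hv0 : ∀ x ∉ Ω, v x = 0) (hV0 : ∀ x ∉ Ω, V x = 0)
    (hη : ContDiff ℝ ∞ η) (hηr : tsupport η ⊆ Metric.closedBall 0 r)
    (hUΩ : ∀ x ∈ U, Metric.closedBall x r ⊆ Ω)
    (hA : ∀ h : Rn N, ‖h‖ ≤ r → ∫⁻ y, ‖ρ (y + h) - ρ y‖ₑ * ‖V y‖ₑ ≤ A) :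
    ∫⁻ x in U, ∫⁻ y, ‖ρ y - ρ x‖ₑ * ‖fderiv ℝ η (x - y)‖ₑ * ‖v x - v y‖ₑ ≤
      (∫⁻ h, ‖fderiv ℝ η h‖ₑ * ‖h‖ₑ) * (2 * A) := by
  have hηc : Continuous (fderiv ℝ η) := hη.continuous_fderiv (by simp)
  have hηm : Measurable (fderiv ℝ η) := hηc.measurable
  have hρ' := hρm.measurable
  have hv' := hvm.measurable
  have hV' := hVm.measurable
  have e1 : ∀ x, ∫⁻ y, ‖ρ y - ρ x‖ₑ * ‖fderiv ℝ η (x - y)‖ₑ * ‖v x - v y‖ₑ =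
      ∫⁻ h, ‖ρ (x - h) - ρ x‖ₑ * ‖fderiv ℝ η h‖ₑ * ‖v x - v (x - h)‖ₑ := by
    intro x
    rw [← lintegral_sub_left_eq_self _ x]
    simp
  simp_rw [e1]
  -- With `h = x - y` as outer variable, it is enough to bound the integral over `x` by `‖fderiv ℝ η
  -- h‖ₑ * ‖h‖ₑ * (2 * A)` for each fixed `h`.
  rw [lintegral_lintegral_swap (by
    refine Measurable.aemeasurable ?_
    rw [Function.uncurry_def]
    fun_prop), ← lintegral_mul_const _ (by fun_prop)]
  refine lintegral_mono fun h => ?_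
  by_cases hh : ‖h‖ ≤ r
  swap
  · have : fderiv ℝ η h = 0 := by
      refine image_eq_zero_of_notMem_tsupport fun hc => hh ?_
      simpa using hηr (tsupport_fderiv_subset ℝ hc)
    have h0 : ‖fderiv ℝ η h‖ₑ = 0 := by
      rw [← ofReal_norm, this, norm_zero, ENNReal.ofReal_zero]
    simp [h0]
  have hae := hvV.ae_sub_translate_eq hU hv hV hVm hv0 hV0 (h := h) fun x hx s hs => by
    refine hUΩ x hx ?_
    rw [Metric.mem_closedBall, dist_eq_norm, sub_sub_cancel_left, norm_neg, norm_smul,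
      Real.norm_of_nonneg hs.1]
    exact (mul_le_of_le_one_left (norm_nonneg _) hs.2).trans hh
  have hbd : ∀ᵐ x, x ∈ U → ‖v x - v (x - h)‖ₑ ≤
      ‖h‖ₑ * ∫⁻ s in Ioo (0 : ℝ) 1, ‖V (x - s • h)‖ₑ := by
    filter_upwards [hae] with x hx hxU
    rw [hx hxU, ← lintegral_const_mul _ (by fun_prop)]
    refine (enorm_integral_le_lintegral_enorm _).trans (lintegral_mono fun s => ?_)
    rw [mul_comm]
    exact (V (x - s • h)).le_opENorm h
  calc ∫⁻ x in U, ‖ρ (x - h) - ρ x‖ₑ * ‖fderiv ℝ η h‖ₑ * ‖v x - v (x - h)‖ₑ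
      ≤ ∫⁻ x in U, (‖fderiv ℝ η h‖ₑ * ‖h‖ₑ) *
          ∫⁻ s in Ioo (0 : ℝ) 1, ‖ρ (x - h) - ρ x‖ₑ * ‖V (x - s • h)‖ₑ := by
        refine setLIntegral_mono_ae' hU.measurableSet ?_
        filter_upwards [hbd] with x hx hxU
        rw [lintegral_const_mul _ (by fun_prop)]
        calc _ ≤ ‖ρ (x - h) - ρ x‖ₑ * ‖fderiv ℝ η h‖ₑ *
              (‖h‖ₑ * ∫⁻ s in Ioo (0 : ℝ) 1, ‖V (x - s • h)‖ₑ) := by gcongr; exact hx hxU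
          _ = _ := by ring
    _ ≤ ∫⁻ x, (‖fderiv ℝ η h‖ₑ * ‖h‖ₑ) *
          ∫⁻ s in Ioo (0 : ℝ) 1, ‖ρ (x - h) - ρ x‖ₑ * ‖V (x - s • h)‖ₑ :=
        setLIntegral_le_lintegral _ _
    _ = (‖fderiv ℝ η h‖ₑ * ‖h‖ₑ) * ∫⁻ x,
          ∫⁻ s in Ioo (0 : ℝ) 1, ‖ρ (x - h) - ρ x‖ₑ * ‖V (x - s • h)‖ₑ := by
        refine lintegral_const_mul _ (Measurable.lintegral_prod_right' (f := fun z : Rn N × ℝ =>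
          ‖ρ (z.1 - h) - ρ z.1‖ₑ * ‖V (z.1 - z.2 • h)‖ₑ) ?_)
        fun_prop
    _ = (‖fderiv ℝ η h‖ₑ * ‖h‖ₑ) * ∫⁻ s in Ioo (0 : ℝ) 1,
          ∫⁻ x, ‖ρ (x - h) - ρ x‖ₑ * ‖V (x - s • h)‖ₑ := by
        congr 1
        refine lintegral_lintegral_swap (Measurable.aemeasurable ?_)
        rw [Function.uncurry_def]
        fun_prop
    _ ≤ (‖fderiv ℝ η h‖ₑ * ‖h‖ₑ) * ∫⁻ s in Ioo (0 : ℝ) 1, (2 * A) := by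
        gcongr 1
        refine setLIntegral_mono' measurableSet_Ioo fun s hs => ?_
        have h1 : ‖s • h‖ ≤ r := by
          rw [norm_smul, Real.norm_of_nonneg hs.1.le]
          exact (mul_le_of_le_one_left (norm_nonneg _) hs.2.le).trans hh
        have h2 : ‖s • h - h‖ ≤ r := by
          rw [show s • h - h = -((1 - s) • h) by module, norm_neg, norm_smul,
            Real.norm_of_nonneg (by linarith [hs.2])]
          exact (mul_le_of_le_one_left (norm_nonneg _) (by linarith [hs.1])).trans hh
        -- Translating by `s • h` puts `V` at `x`. Inserting `ρ x` then splits the difference of `ρ`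
        -- into two, with shifts `s • h - h` and `s • h` of norm at most `r`; hence the factor 2.
        calc ∫⁻ x, ‖ρ (x - h) - ρ x‖ₑ * ‖V (x - s • h)‖ₑ
            = ∫⁻ x, ‖ρ (x + (s • h - h)) - ρ (x + s • h)‖ₑ * ‖V x‖ₑ := by
              rw [← lintegral_add_right_eq_self _ (s • h)]
              simp [add_sub_assoc]
          _ ≤ ∫⁻ x, (‖ρ (x + (s • h - h)) - ρ x‖ₑ * ‖V x‖ₑ +
                ‖ρ (x + s • h) - ρ x‖ₑ * ‖V x‖ₑ) := by
              refine lintegral_mono fun x => ?_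
              rw [← add_mul]
              gcongr
              rw [← sub_sub_sub_cancel_right _ _ (ρ x)]
              exact enorm_sub_le
          _ = (∫⁻ x, ‖ρ (x + (s • h - h)) - ρ x‖ₑ * ‖V x‖ₑ) +
                ∫⁻ x, ‖ρ (x + s • h) - ρ x‖ₑ * ‖V x‖ₑ := lintegral_add_left (by fun_prop) _
          _ ≤ A + A := add_le_add (hA _ h2) (hA _ h1)
          _ = 2 * A := (two_mul A).symm
    _ = _ := by simp

/-- The integral of a directional derivative of a compactly supported function vanishes. -/
theorem integral_fderiv_apply_eq_zero {η : Rn N → ℝ} (hη : ContDiff ℝ ∞ η)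
    (hηc : HasCompactSupport η) (w : Rn N) : ∫ x, fderiv ℝ η x w = 0 := by
  have hd := hη.continuous_fderiv (by simp)
  have hi : Integrable fun x => fderiv ℝ η x w :=
    Continuous.integrable_of_hasCompactSupport (by fun_prop)
      ((hηc.fderiv (𝕜 := ℝ)).comp_left (g := fun L : Rn N →L[ℝ] ℝ => L w) rfl)
  have key := integral_mul_fderiv_eq_neg_fderiv_mul_of_integrable (μ := volume)
    (f := fun _ : Rn N => (1 : ℝ)) (g := η) (v := w) (by simp) (by simpa using hi)
    (by simpa using hη.continuous.integrable_of_hasCompactSupport hηc)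
    (fun x _ => differentiableAt_const _) (fun x _ => hη.differentiable (by simp) x)
  simpa using key

end Commutator

/-! ### Mollified density, mollified flux and the defect at a fixed time. -/

section Mollify

variable {N : ℕ}

/-- The mollification `ρ * η`. -/
noncomputable def mollify (η ρ : Rn N → ℝ) (x : Rn N) : ℝ := ∫ y, ρ y * η (x - y)

/-- The mollified transport term `∫ ρ(y) ∇η(x - y) · v(y) dy`. -/
noncomputable def mollifiedFlux (η ρ : Rn N → ℝ) (v : Rn N → Rn N) (x : Rn N) : ℝ :=
  ∫ y, ρ y * fderiv ℝ η (x - y) (v y)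

theorem mollify_eq_convolution (η ρ : Rn N → ℝ) :
    mollify η ρ = MeasureTheory.convolution ρ η (ContinuousLinearMap.lsmul ℝ ℝ) volume := rfl

theorem contDiff_mollify {η ρ : Rn N → ℝ} (hη : ContDiff ℝ ∞ η) (hηc : HasCompactSupport η)
    (hρ : Integrable ρ) : ContDiff ℝ ∞ (mollify η ρ) := by
  rw [mollify_eq_convolution]
  exact hηc.contDiff_convolution_right _ hρ.locallyIntegrable hη

theorem fderiv_mollify_apply {η ρ : Rn N → ℝ} (hη : ContDiff ℝ ∞ η) (hηc : HasCompactSupport η)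
    (hρ : Integrable ρ) (x w : Rn N) :
    fderiv ℝ (mollify η ρ) x w = ∫ y, ρ y * fderiv ℝ η (x - y) w := by
  rw [mollify_eq_convolution, (hηc.hasFDerivAt_convolution_right
    (ContinuousLinearMap.lsmul ℝ ℝ) hρ.locallyIntegrable (hη.of_le (by simp)) x).fderiv,
    convolution_precompR_apply _ hρ.locallyIntegrable (hηc.fderiv (𝕜 := ℝ))
      (hη.continuous_fderiv (by simp))]
  rfl

theorem integrable_fderiv_sub_apply {η : Rn N → ℝ} (hη : ContDiff ℝ ∞ η)
    (hηc : HasCompactSupport η) {w : Rn N → Rn N} (hw : Integrable w) (x : Rn N) :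
    Integrable fun y => fderiv ℝ η (x - y) (w y) := by
  have hd := hη.continuous_fderiv (by simp)
  obtain ⟨C, hC⟩ := hd.bounded_above_of_compact_support (hηc.fderiv (𝕜 := ℝ))
  have hc : Continuous fun y => fderiv ℝ η (x - y) := by fun_prop
  refine (hw.norm.const_mul C).mono' ?_ (ae_of_all _ fun y => ?_)
  · exact (ContinuousLinearMap.apply ℝ ℝ).flip.aestronglyMeasurable_comp₂
      hc.aestronglyMeasurable hw.1
  · exact (ContinuousLinearMap.le_opNorm _ _).trans
      (mul_le_mul_of_nonneg_right (hC _) (norm_nonneg _))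

theorem fderiv_comp_const_sub {η : Rn N → ℝ} (hη : ContDiff ℝ ∞ η) (x y : Rn N) :
    fderiv ℝ (fun y => η (x - y)) y = -fderiv ℝ η (x - y) := by
  have h1 : HasFDerivAt (fun y : Rn N => x - y) (-ContinuousLinearMap.id ℝ (Rn N)) y :=
    (hasFDerivAt_id y).const_sub x
  have h2 := (hη.differentiable (by simp) (x - y)).hasFDerivAt.comp y h1
  rw [show (fun y => η (x - y)) = η ∘ fun y => x - y from rfl, h2.fderiv]
  ext w
  simp

/-- The commutator of mollification and transport by a divergence-free field. -/
theorem fderiv_mollify_sub_mollifiedFlux {Ω : Set (Rn N)} {η ρ : Rn N → ℝ} {v : Rn N → Rn N}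
    (hη : ContDiff ℝ ∞ η) (hηc : HasCompactSupport η) (hρ : Integrable ρ) (hv : Integrable v)
    (hρv : Integrable fun x => ρ x • v x) (hv0 : ∀ x ∉ Ω, v x = 0) (hdiv : IsWeaklyDivFree Ω v)
    {r : ℝ} (hηr : tsupport η ⊆ Metric.closedBall 0 r) {x : Rn N}
    (hx : Metric.closedBall x r ⊆ Ω) :
    fderiv ℝ (mollify η ρ) x (v x) - mollifiedFlux η ρ v x =
      ∫ y, (ρ y - ρ x) * fderiv ℝ η (x - y) (v x - v y) := by
  have i1 : Integrable fun y => ρ y * fderiv ℝ η (x - y) (v x) := by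
    have := integrable_fderiv_sub_apply hη hηc (hρ.smul_const (v x)) x
    simpa using this
  have i2 : Integrable fun y => ρ y * fderiv ℝ η (x - y) (v y) := by
    simpa using integrable_fderiv_sub_apply hη hηc hρv x
  have i3 : Integrable fun y => fderiv ℝ η (x - y) (v x) := by
    have hd := hη.continuous_fderiv (by simp)
    have : Integrable fun y => fderiv ℝ η y (v x) :=
      Continuous.integrable_of_hasCompactSupport (by fun_prop)
        ((hηc.fderiv (𝕜 := ℝ)).comp_left (g := fun L : Rn N →L[ℝ] ℝ => L (v x)) rfl)
    exact this.comp_sub_left x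
  have i4 := integrable_fderiv_sub_apply hη hηc hv x
  -- The next two integrals vanish, the first by compact support of `η`, the second because `v` is
  -- divergence-free. They allow `ρ x` to be subtracted from `ρ y` at no cost.
  have z3 : ∫ y, fderiv ℝ η (x - y) (v x) = 0 := by
    rw [integral_sub_left_eq_self (fun y => fderiv ℝ η y (v x))]
    exact integral_fderiv_apply_eq_zero hη hηc _
  have z4 : ∫ y, fderiv ℝ η (x - y) (v y) = 0 := by
    have htest : IsTestFunction Ω (fun y => η (x - y)) := by
      refine ⟨hη.comp (contDiff_const.sub contDiff_id),
        hηc.comp_homeomorph (Homeomorph.subLeft x), ?_⟩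
      refine (tsupport_comp_subset_preimage η (by fun_prop)).trans fun y hy => hx ?_
      have := hηr hy
      rwa [Metric.mem_closedBall, dist_comm, dist_eq_norm, ← mem_closedBall_zero_iff]
    have key := hdiv _ htest
    rw [setIntegral_eq_integral_of_forall_compl_eq_zero fun y hy => by
        rw [hv0 y hy, map_zero]] at key
    simp only [fderiv_comp_const_sub hη, neg_apply] at key
    rw [integral_neg] at key
    linarith
  have e : ∀ y, (ρ y - ρ x) * fderiv ℝ η (x - y) (v x - v y) =
      (ρ y * fderiv ℝ η (x - y) (v x) - ρ y * fderiv ℝ η (x - y) (v y)) -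
        ρ x * (fderiv ℝ η (x - y) (v x) - fderiv ℝ η (x - y) (v y)) := by
    intro y
    rw [map_sub]
    ring
  simp_rw [e]
  have i12 : Integrable fun y => ρ y * fderiv ℝ η (x - y) (v x) -
    ρ y * fderiv ℝ η (x - y) (v y) := i1.sub i2
  have i34 : Integrable fun y => fderiv ℝ η (x - y) (v x) - fderiv ℝ η (x - y) (v y) := i3.sub i4
  rw [integral_sub i12 (i34.const_mul _), integral_const_mul, integral_sub i1 i2,
    integral_sub i3 i4, z3, z4, fderiv_mollify_apply hη hηc hρ]
  simp [mollifiedFlux]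

theorem stronglyMeasurable_mollifiedFlux {η ρ : Rn N → ℝ} {v : Rn N → Rn N}
    (hη : ContDiff ℝ ∞ η) (hρm : StronglyMeasurable ρ) (hvm : StronglyMeasurable v) :
    StronglyMeasurable (mollifiedFlux η ρ v) := by
  have hd := hη.continuous_fderiv (by simp)
  refine StronglyMeasurable.integral_prod_right
    (f := fun x y => ρ y * fderiv ℝ η (x - y) (v y)) ?_
  refine (hρm.comp_measurable measurable_snd).mul ?_
  have hc : Continuous fun z : Rn N × Rn N => fderiv ℝ η (z.1 - z.2) := by fun_prop
  exact (isBoundedBilinearMap_apply (𝕜 := ℝ) (E := Rn N) (F := ℝ)).continuous.comp_stronglyMeasurable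
    (hc.stronglyMeasurable.prodMk (hvm.comp_measurable measurable_snd))

/-- A crude bound, not uniform in the scale of `η`; it serves only for integrability and Fubini at
fixed `η`. -/
theorem norm_mollifiedFlux_le {η ρ : Rn N → ℝ} {v : Rn N → Rn N} {C : ℝ}
    (hC : ∀ x, ‖fderiv ℝ η x‖ ≤ C) (hρv : Integrable fun x => ρ x • v x) (x : Rn N) :
    ‖mollifiedFlux η ρ v x‖ ≤ C * ∫ y, ‖ρ y • v y‖ := by
  rw [← integral_const_mul]
  refine norm_integral_le_of_norm_le (hρv.norm.const_mul C) (ae_of_all _ fun y => ?_)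
  rw [norm_mul, norm_smul, mul_left_comm]
  gcongr
  exact (ContinuousLinearMap.le_opNorm _ _).trans
      (mul_le_mul_of_nonneg_right (hC _) (norm_nonneg _))

theorem norm_mollify_le {η ρ : Rn N → ℝ} {C : ℝ}
    (hC : ∀ x, ‖η x‖ ≤ C) (hρ : Integrable ρ) (x : Rn N) :
    ‖mollify η ρ x‖ ≤ C * ∫ y, ‖ρ y‖ := by
  rw [← integral_const_mul]
  refine norm_integral_le_of_norm_le (hρ.norm.const_mul C) (ae_of_all _ fun y => ?_)
  rw [norm_mul, mul_comm]
  gcongr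
  exact hC _

/-- At a fixed time, the defect in the renormalized equation for the mollified density is
controlled by the commutator. -/
theorem enorm_renormalization_defect_le {Ω U : Set (Rn N)} (hU : IsOpen U)
    {ρ : Rn N → ℝ} {v : Rn N → Rn N} {V : Rn N → (Rn N →L[ℝ] Rn N)} {η φ : Rn N → ℝ}
    {β : ℝ → ℝ} {r C : ℝ} {A : ℝ≥0∞}
    (hvV : HasWeakFDerivOn Ω v V) (hρ : Integrable ρ) (hv : Integrable v) (hV : Integrable V)
    (hρv : Integrable fun x => ρ x • v x)
    (hρm : StronglyMeasurable ρ) (hvm : StronglyMeasurable v) (hVm : StronglyMeasurable V)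
    (hv0 : ∀ x ∉ Ω, v x = 0) (hV0 : ∀ x ∉ Ω, V x = 0) (hdiv : IsWeaklyDivFree Ω v)
    (hη : ContDiff ℝ ∞ η) (hηc : HasCompactSupport η) (hηr : tsupport η ⊆ Metric.closedBall 0 r)
    (hUΩ : ∀ x ∈ U, Metric.closedBall x r ⊆ Ω)
    (hA : ∀ h : Rn N, ‖h‖ ≤ r → ∫⁻ y, ‖ρ (y + h) - ρ y‖ₑ * ‖V y‖ₑ ≤ A)
    (hφ : ContDiff ℝ ∞ φ) (hφc : HasCompactSupport φ) (hφU : tsupport φ ⊆ U)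
    (hφΩ : tsupport φ ⊆ Ω) (hβ : ContDiff ℝ ∞ β) (hC : ∀ x s, ‖φ x * deriv β s‖ ≤ C) :
    ‖(∫ x, φ x * (deriv β (mollify η ρ x) * mollifiedFlux η ρ v x)) +
        ∫ x, β (mollify η ρ x) * fderiv ℝ φ x (v x)‖ₑ ≤
      ENNReal.ofReal C * ((∫⁻ h, ‖fderiv ℝ η h‖ₑ * ‖h‖ₑ) * (2 * A)) := by
  set m := mollify η ρ with hm
  have hmsm : ContDiff ℝ ∞ m := contDiff_mollify hη hηc hρ
  have hβm : ContDiff ℝ ∞ fun x => β (m x) := hβ.comp hmsm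
  have hβ' : Continuous (deriv β) := hβ.continuous_deriv (by simp)
  have hmd := hmsm.continuous_fderiv (by simp)
  have hφd := hφ.continuous_fderiv (by simp)
  have hprod : ∀ x w, fderiv ℝ (fun x => φ x * β (m x)) x w =
      φ x * (deriv β (m x) * fderiv ℝ m x w) + β (m x) * fderiv ℝ φ x w := by
    intro x w
    have hb : HasFDerivAt (fun x => β (m x)) (deriv β (m x) • fderiv ℝ m x) x :=
      (hβ.differentiable (by simp) (m x)).hasDerivAt.comp_hasFDerivAt x
        (hmsm.differentiable (by simp) x).hasFDerivAt
    rw [((hφ.differentiable (by simp) x).hasFDerivAt.fun_mul hb).fderiv]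
    simp
  -- This needs `β` smooth, since only `C^∞` functions are admitted in `IsWeaklyDivFree`.
  have htest : IsTestFunction Ω fun x => φ x * β (m x) :=
    ⟨hφ.mul hβm, hφc.mul_right, (tsupport_mul_subset_left).trans hφΩ⟩
  have hbd : ∀ {L : Rn N → (Rn N →L[ℝ] ℝ)}, Continuous L → HasCompactSupport L →
      Integrable fun x => L x (v x) := by
    intro L hL hLc
    obtain ⟨B, hB⟩ := hL.bounded_above_of_compact_support hLc
    refine (hv.norm.const_mul B).mono' ?_ (ae_of_all _ fun y => ?_)
    · exact (ContinuousLinearMap.apply ℝ ℝ).flip.aestronglyMeasurable_comp₂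
        hL.aestronglyMeasurable hv.1
    · exact (ContinuousLinearMap.le_opNorm _ _).trans
        (mul_le_mul_of_nonneg_right (hB _) (norm_nonneg _))
  have i1 : Integrable fun x => φ x * (deriv β (m x) * fderiv ℝ m x (v x)) := by
    have := hbd (L := fun x => φ x • (deriv β (m x) • fderiv ℝ m x))
      (by have := hφ.continuous; have := hmsm.continuous; fun_prop) hφc.smul_right
    simpa using this
  have i2 : Integrable fun x => β (m x) * fderiv ℝ φ x (v x) := by
    have := hbd (L := fun x => β (m x) • fderiv ℝ φ x)
      (by have := hβm.continuous; fun_prop)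
      (HasCompactSupport.smul_left (f := fun x => β (m x)) (f' := fderiv ℝ φ)
        (hφc.fderiv (𝕜 := ℝ)))
    simpa using this
  have hdiv0 : (∫ x, φ x * (deriv β (m x) * fderiv ℝ m x (v x))) +
      ∫ x, β (m x) * fderiv ℝ φ x (v x) = 0 := by
    rw [← integral_add i1 i2, ← hdiv _ htest,
      setIntegral_eq_integral_of_forall_compl_eq_zero fun y hy => by
        rw [hv0 y hy, map_zero]]
    simp only [hprod]
  obtain ⟨Cη, hCη⟩ := (hη.continuous_fderiv (by simp)).bounded_above_of_compact_support
    (hηc.fderiv (𝕜 := ℝ))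
  have i3 : Integrable fun x => φ x * (deriv β (m x) * mollifiedFlux η ρ v x) := by
    have h1 : Integrable fun x => φ x * deriv β (m x) :=
      Continuous.integrable_of_hasCompactSupport
        (by have := hφ.continuous; have := hmsm.continuous; fun_prop) hφc.mul_right
    have := h1.mul_bdd (c := Cη * ∫ y, ‖ρ y • v y‖)
      (stronglyMeasurable_mollifiedFlux hη hρm hvm).aestronglyMeasurable
      (ae_of_all _ fun x => norm_mollifiedFlux_le hCη hρv x)
    simpa only [mul_assoc] using this
  -- By `hdiv0` the term in `fderiv ℝ φ` is minus the transport term of `m`, so the sum becomes a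
  -- commutator.
  have e : (∫ x, φ x * (deriv β (m x) * mollifiedFlux η ρ v x)) +
      ∫ x, β (m x) * fderiv ℝ φ x (v x) =
      ∫ x, (φ x * (deriv β (m x) * mollifiedFlux η ρ v x) -
        φ x * (deriv β (m x) * fderiv ℝ m x (v x))) := by
    rw [integral_sub i3 i1]
    linarith
  rw [e]
  have hpt : ∀ x, ‖φ x * (deriv β (m x) * mollifiedFlux η ρ v x) -
        φ x * (deriv β (m x) * fderiv ℝ m x (v x))‖ₑ ≤ U.indicator (fun x => ENNReal.ofReal C *
      ∫⁻ y, ‖ρ y - ρ x‖ₑ * ‖fderiv ℝ η (x - y)‖ₑ * ‖v x - v y‖ₑ) x := by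
    intro x
    by_cases hx : x ∈ U
    swap
    · simp [image_eq_zero_of_notMem_tsupport fun hc => hx (hφU hc), hx]
    rw [indicator_of_mem hx]
    have : φ x * (deriv β (m x) * mollifiedFlux η ρ v x) -
        φ x * (deriv β (m x) * fderiv ℝ m x (v x)) = - ((φ x * deriv β (m x)) *
          (fderiv ℝ m x (v x) - mollifiedFlux η ρ v x)) := by ring
    rw [this, enorm_neg, enorm_mul, fderiv_mollify_sub_mollifiedFlux hη hηc hρ hv hρv hv0 hdiv
      hηr (hUΩ x hx), ← ofReal_norm (φ x * deriv β (m x))]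
    gcongr
    · exact hC _ _
    · refine (enorm_integral_le_lintegral_enorm _).trans (lintegral_mono fun y => ?_)
      rw [enorm_mul, mul_assoc]
      gcongr
      exact ContinuousLinearMap.le_opENorm _ _
  calc _ ≤ ∫⁻ x, U.indicator (fun x => ENNReal.ofReal C *
        ∫⁻ y, ‖ρ y - ρ x‖ₑ * ‖fderiv ℝ η (x - y)‖ₑ * ‖v x - v y‖ₑ) x :=
        (enorm_integral_le_lintegral_enorm _).trans (lintegral_mono hpt)
    _ = ENNReal.ofReal C *
        ∫⁻ x in U, ∫⁻ y, ‖ρ y - ρ x‖ₑ * ‖fderiv ℝ η (x - y)‖ₑ * ‖v x - v y‖ₑ := by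
        rw [lintegral_indicator hU.measurableSet]
        exact lintegral_const_mul' _ _ ENNReal.ofReal_ne_top
    _ ≤ _ := by
        gcongr
        exact lintegral_commutator_le hU hvV hv hV hρm hvm hVm hv0 hV0 hη hηr hUΩ hA

end Mollify

/-! ### The equation satisfied by the mollified density. -/

section SpaceTime

variable {N : ℕ}

theorem fderiv_partial_space {φ : ℝ × Rn N → ℝ} (hφ : ContDiff ℝ ∞ φ) (t : ℝ) (x w : Rn N) :
    fderiv ℝ (fun y => φ (t, y)) x w = fderiv ℝ φ (t, x) (0, w) := by
  have h1 : HasFDerivAt (fun y : Rn N => (t, y)) (ContinuousLinearMap.inr ℝ ℝ (Rn N)) x :=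
    hasFDerivAt_prodMk_right t x
  have h2 := (hφ.differentiable (by simp) (t, x)).hasFDerivAt.comp x h1
  rw [show (fun y => φ (t, y)) = φ ∘ fun y => (t, y) from rfl, h2.fderiv]
  simp

theorem deriv_partial_time {φ : ℝ × Rn N → ℝ} (hφ : ContDiff ℝ ∞ φ) (t : ℝ) (x : Rn N) :
    deriv (fun s => φ (s, x)) t = fderiv ℝ φ (t, x) (1, 0) := by
  have h1 : HasDerivAt (fun s : ℝ => (s, x)) ((1 : ℝ), (0 : Rn N)) t :=
    (hasDerivAt_id t).prodMk (hasDerivAt_const t x)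
  exact ((hφ.differentiable (by simp) (t, x)).hasFDerivAt.comp_hasDerivAt t h1).deriv

theorem stronglyMeasurable_mollify_prod {η : Rn N → ℝ} (hη : Continuous η) {ρ : ℝ → Rn N → ℝ}
    (hρ : StronglyMeasurable fun z : ℝ × Rn N => ρ z.1 z.2) :
    StronglyMeasurable fun z : ℝ × Rn N => mollify η (ρ z.1) z.2 := by
  refine StronglyMeasurable.integral_prod_right
    (f := fun (z : ℝ × Rn N) y => ρ z.1 y * η (z.2 - y)) ?_
  refine (hρ.comp_measurable (g := fun w : (ℝ × Rn N) × Rn N => (w.1.1, w.2))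
    (by fun_prop)).mul (Continuous.stronglyMeasurable ?_)
  fun_prop

theorem stronglyMeasurable_mollifiedFlux_prod {η : Rn N → ℝ} (hη : ContDiff ℝ ∞ η)
    {ρ : ℝ → Rn N → ℝ} {u : ℝ → Rn N → Rn N}
    (hρ : StronglyMeasurable fun z : ℝ × Rn N => ρ z.1 z.2)
    (hu : StronglyMeasurable fun z : ℝ × Rn N => u z.1 z.2) :
    StronglyMeasurable fun z : ℝ × Rn N => mollifiedFlux η (ρ z.1) (u z.1) z.2 := by
  have hd := hη.continuous_fderiv (by simp)
  have hm : Measurable fun w : (ℝ × Rn N) × Rn N => (w.1.1, w.2) := by fun_prop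
  refine StronglyMeasurable.integral_prod_right
    (f := fun (z : ℝ × Rn N) y => ρ z.1 y * fderiv ℝ η (z.2 - y) (u z.1 y)) ?_
  refine (hρ.comp_measurable hm).mul ?_
  have hc : Continuous fun w : (ℝ × Rn N) × Rn N => fderiv ℝ η (w.1.2 - w.2) := by fun_prop
  exact (isBoundedBilinearMap_apply (𝕜 := ℝ) (E := Rn N)
    (F := ℝ)).continuous.comp_stronglyMeasurable
      (hc.stronglyMeasurable.prodMk (hu.comp_measurable hm))

/-- The mollified density solves, at each interior point, an ordinary differential equation in
time. -/
theorem SatisfiesWeakTransport.mollify {Ω : Set (Rn N)} {T : ℝ} {u : ℝ → Rn N → Rn N}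
    {ρ₀ : Rn N → ℝ} {ρ : ℝ → Rn N → ℝ} (hsol : SatisfiesWeakTransport T Ω u ρ₀ ρ)
    (hρ0 : ∀ t, ∀ x ∉ Ω, ρ t x = 0) (hρ₀0 : ∀ x ∉ Ω, ρ₀ x = 0)
    {η : Rn N → ℝ} (hη : ContDiff ℝ ∞ η) {r : ℝ}
    (hηr : tsupport η ⊆ Metric.closedBall 0 r) {x : Rn N} (hx : Metric.closedBall x r ⊆ Ω)
    {ψ : ℝ → ℝ} (hψ : ContDiff ℝ ∞ ψ) (hψc : HasCompactSupport ψ) (hψT : tsupport ψ ⊆ Iio T) :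
    (∫ t in Ioo 0 T, deriv ψ t * mollify η (ρ t) x) + ψ 0 * mollify η ρ₀ x +
      ∫ t in Ioo 0 T, ψ t * mollifiedFlux η (ρ t) (u t) x = 0 := by
  have hηx : tsupport (fun y => η (x - y)) ⊆ Metric.closedBall x r := by
    refine (tsupport_comp_subset_preimage η (by fun_prop)).trans fun y hy => ?_
    have := hηr hy
    rwa [Metric.mem_closedBall, dist_comm, dist_eq_norm, ← mem_closedBall_zero_iff]
  have hts : tsupport (fun z : ℝ × Rn N => ψ z.1 * η (x - z.2)) ⊆
      tsupport ψ ×ˢ tsupport fun y => η (x - y) := by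
    refine closure_minimal (fun z hz => ?_)
      ((isClosed_tsupport _).prod (isClosed_tsupport _))
    have hz' := mul_ne_zero_iff.1 hz
    exact ⟨subset_tsupport _ hz'.1, subset_tsupport (fun y => η (x - y)) hz'.2⟩
  have htest : IsSpaceTimeTestFunction T Ω fun z : ℝ × Rn N => ψ z.1 * η (x - z.2) := by
    refine ⟨(hψ.comp contDiff_fst).mul (hη.comp (contDiff_const.sub contDiff_snd)), ?_,
      hts.trans (prod_mono hψT (hηx.trans hx))⟩
    exact HasCompactSupport.of_support_subset_isCompact
      (hψc.isCompact.prod ((isCompact_closedBall x r).of_isClosed_subset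
        (isClosed_tsupport _) hηx)) ((subset_tsupport _).trans hts)
  have key := hsol _ htest
  have e1 : ∀ t, ∫ y in Ω, ρ t y * deriv (fun s => ψ s * η (x - y)) t =
      deriv ψ t * _root_.mollify η (ρ t) x := by
    intro t
    rw [setIntegral_eq_integral_of_forall_compl_eq_zero fun y hy => by simp [hρ0 t y hy],
      _root_.mollify, ← integral_const_mul]
    refine integral_congr_ae (ae_of_all _ fun y => ?_)
    simp only
    rw [deriv_mul_const (hψ.differentiable (by simp) t)]
    ring
  have e2 : ∫ y in Ω, ρ₀ y * (ψ 0 * η (x - y)) = ψ 0 * _root_.mollify η ρ₀ x := by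
    rw [setIntegral_eq_integral_of_forall_compl_eq_zero fun y hy => by simp [hρ₀0 y hy],
      _root_.mollify, ← integral_const_mul]
    refine integral_congr_ae (ae_of_all _ fun y => ?_)
    simp only
    ring
  -- The minus sign comes from differentiating `η (x - y)` in `y`.
  have e3 : ∀ t, ∫ y in Ω, ρ t y * fderiv ℝ (fun y => ψ t * η (x - y)) y (u t y) =
      -(ψ t * mollifiedFlux η (ρ t) (u t) x) := by
    intro t
    rw [setIntegral_eq_integral_of_forall_compl_eq_zero fun y hy => by
      rw [hρ0 t y hy, zero_mul], mollifiedFlux, ← integral_const_mul, ← integral_neg]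
    refine integral_congr_ae (ae_of_all _ fun y => ?_)
    have hd : DifferentiableAt ℝ (fun y => η (x - y)) y :=
      (hη.comp (contDiff_const.sub contDiff_id)).differentiable (by simp) y
    simp only
    rw [fderiv_const_mul hd, fderiv_comp_const_sub hη]
    simp only [smul_apply, neg_apply, smul_eq_mul]
    ring
  simp only [e1, e2, e3, integral_neg] at key
  linarith

/-- The renormalized equation for the mollified density, with the mollified flux. -/
theorem mollified_renormalized_equation {Ω : Set (Rn N)} {T : ℝ} (hT : 0 < T)
    {u : ℝ → Rn N → Rn N} {ρ₀ : Rn N → ℝ} {ρ : ℝ → Rn N → ℝ}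
    (hsol : SatisfiesWeakTransport T Ω u ρ₀ ρ)
    (hρm : StronglyMeasurable fun z : ℝ × Rn N => ρ z.1 z.2)
    (hum : StronglyMeasurable fun z : ℝ × Rn N => u z.1 z.2)
    (hρ0 : ∀ t, ∀ x ∉ Ω, ρ t x = 0) (hρ₀0 : ∀ x ∉ Ω, ρ₀ x = 0) (hρ₀ : Integrable ρ₀) {M : ℝ}
    (hρ : ∀ᵐ t ∂(volume.restrict (Ioo 0 T)), Integrable (ρ t) ∧ ∫ y, ‖ρ t y‖ ≤ M)
    (hρu : Integrable (fun z : ℝ × Rn N => ρ z.1 z.2 • u z.1 z.2)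
      ((volume.restrict (Ioo 0 T)).prod volume))
    {η : Rn N → ℝ} (hη : ContDiff ℝ ∞ η) (hηc : HasCompactSupport η) {r : ℝ}
    (hηr : tsupport η ⊆ Metric.closedBall 0 r)
    {φ : ℝ × Rn N → ℝ} (hφ : IsSpaceTimeTestFunction T Ω φ)
    (hφr : ∀ z ∈ tsupport φ, Metric.closedBall z.2 r ⊆ Ω)
    {β : ℝ → ℝ} {Cβ : ℝ} {K : NNReal} (hβ : ContDiff ℝ ∞ β) (hβC : ∀ s, ‖β s‖ ≤ Cβ)
    (hβK : LipschitzWith K β) :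
    Integrable (fun z : ℝ × Rn N => φ z * (deriv β (mollify η (ρ z.1) z.2) *
      mollifiedFlux η (ρ z.1) (u z.1) z.2)) ((volume.restrict (Ioo 0 T)).prod volume) ∧
    (∫ z, fderiv ℝ φ z (1, 0) * β (mollify η (ρ z.1) z.2)
        ∂((volume.restrict (Ioo 0 T)).prod volume)) +
      (∫ x, φ (0, x) * β (mollify η ρ₀ x)) +
      ∫ z, φ z * (deriv β (mollify η (ρ z.1) z.2) * mollifiedFlux η (ρ z.1) (u z.1) z.2)
        ∂((volume.restrict (Ioo 0 T)).prod volume) = 0 := by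
  obtain ⟨hφs, hφc, hφT⟩ := hφ
  have hφd := hφs.continuous_fderiv (by simp)
  have hβ' : Continuous (deriv β) := hβ.continuous_deriv (by simp)
  have hβ'K : ∀ s, ‖deriv β s‖ ≤ K := fun s => norm_deriv_le_of_lipschitz hβK
  have hmm := stronglyMeasurable_mollify_prod hη.continuous hρm
  have hfm := stronglyMeasurable_mollifiedFlux_prod hη hρm hum
  obtain ⟨Cη, hCη⟩ := hη.continuous.bounded_above_of_compact_support hηc
  obtain ⟨Cη', hCη'⟩ := (hη.continuous_fderiv (by simp)).bounded_above_of_compact_support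
    (hηc.fderiv (𝕜 := ℝ))
  have hCη0 : 0 ≤ Cη := (norm_nonneg _).trans (hCη 0)
  obtain ⟨Cφ, hCφ⟩ := hφs.continuous.bounded_above_of_compact_support hφc
  have i1 : Integrable (fun z : ℝ × Rn N => fderiv ℝ φ z (1, 0) * β (mollify η (ρ z.1) z.2))
      ((volume.restrict (Ioo 0 T)).prod volume) := by
    have : Integrable (fun z : ℝ × Rn N => fderiv ℝ φ z (1, 0))
        ((volume.restrict (Ioo 0 T)).prod volume) :=
      Continuous.integrable_of_hasCompactSupport (by fun_prop)
        ((hφc.fderiv (𝕜 := ℝ)).comp_left (g := fun L : (ℝ × Rn N) →L[ℝ] ℝ => L (1, 0)) rfl)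
    exact this.mul_bdd (c := Cβ)
      (hβ.continuous.comp_stronglyMeasurable hmm).aestronglyMeasurable
      (ae_of_all _ fun z => hβC _)
  have hS : IsCompact (Prod.snd '' tsupport φ) := hφc.isCompact.image continuous_snd
  have hbound : ∀ᵐ t ∂(volume.restrict (Ioo 0 T)), ∀ x,
      ‖mollifiedFlux η (ρ t) (u t) x‖ ≤ Cη' * ∫ y, ‖ρ t y • u t y‖ := by
    filter_upwards [hρu.prod_right_ae] with t ht x
    exact norm_mollifiedFlux_le hCη' ht x
  have i3 : Integrable (fun z : ℝ × Rn N => φ z * (deriv β (mollify η (ρ z.1) z.2) *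
      mollifiedFlux η (ρ z.1) (u z.1) z.2)) ((volume.restrict (Ioo 0 T)).prod volume) := by
    -- The majorant is a product: an integrable function of time and a bounded function on the
    -- compact spatial projection of the support of `φ`.
    have hg : Integrable (fun z : ℝ × Rn N => (Cη' * ∫ y, ‖ρ z.1 y • u z.1 y‖) *
        (Prod.snd '' tsupport φ).indicator (fun _ => Cφ * K) z.2)
        ((volume.restrict (Ioo 0 T)).prod volume) :=
      Integrable.mul_prod (f := fun t => Cη' * ∫ y, ‖ρ t y • u t y‖)
        (hρu.integral_norm_prod_left.const_mul Cη')
        ((integrable_indicator_iff hS.measurableSet).2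
          (integrableOn_const hS.measure_lt_top.ne))
    refine hg.mono' ?_ ?_
    · exact (hφs.continuous.stronglyMeasurable.mul
        ((hβ'.comp_stronglyMeasurable hmm).mul hfm)).aestronglyMeasurable
    · have hb2 := Measure.quasiMeasurePreserving_fst (μ := volume.restrict (Ioo 0 T))
        (ν := (volume : Measure (Rn N))) |>.ae hbound
      filter_upwards [hb2] with z hz
      by_cases hzφ : z ∈ tsupport φ
      · rw [indicator_of_mem (mem_image_of_mem _ hzφ), norm_mul, norm_mul]
        calc ‖φ z‖ * (‖deriv β (mollify η (ρ z.1) z.2)‖ * ‖mollifiedFlux η (ρ z.1) (u z.1) z.2‖)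
            ≤ Cφ * (K * (Cη' * ∫ y, ‖ρ z.1 y • u z.1 y‖)) := by
              gcongr
              · exact (norm_nonneg _).trans (hCφ z)
              · exact hCφ z
              · exact hβ'K _
              · exact hz _
          _ = _ := by ring
      · rw [image_eq_zero_of_notMem_tsupport hzφ, zero_mul, norm_zero]
        refine mul_nonneg ((norm_nonneg _).trans (hz z.2)) (indicator_nonneg (fun _ _ => ?_) _)
        exact mul_nonneg ((norm_nonneg _).trans (hCφ z)) K.2
  refine ⟨i3, ?_⟩
  -- The identity holds for each `x` separately: by the chain rule in time over the projected
  -- support, trivially elsewhere. Fubini then assembles it.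
  have hpt : ∀ x, (∫ t in Ioo 0 T, fderiv ℝ φ (t, x) (1, 0) * β (mollify η (ρ t) x)) +
      φ (0, x) * β (mollify η ρ₀ x) + ∫ t in Ioo 0 T, φ (t, x) *
        (deriv β (mollify η (ρ t) x) * mollifiedFlux η (ρ t) (u t) x) = 0 := by
    intro x
    by_cases hx : x ∈ Prod.snd '' tsupport φ
    · have hxr : Metric.closedBall x r ⊆ Ω := by
        obtain ⟨z, hz, rfl⟩ := hx
        exact hφr z hz
      have hψs : ContDiff ℝ ∞ fun t => φ (t, x) := hφs.comp (contDiff_id.prodMk contDiff_const)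
      have hψt : (fun t => φ (t, x)) T = 0 :=
        image_eq_zero_of_notMem_tsupport fun h => lt_irrefl T (hφT h).1
      have hf : IntegrableOn (fun t => mollify η (ρ t) x) (Ioo 0 T) := by
        refine Integrable.mono' (integrable_const (Cη * M))
          (hmm.comp_measurable (g := fun t : ℝ => (t, x)) (by fun_prop)).aestronglyMeasurable ?_
        filter_upwards [hρ] with t ht
        exact (norm_mollify_le hCη ht.1 x).trans (by gcongr; exact ht.2)
      have hg : IntegrableOn (fun t => mollifiedFlux η (ρ t) (u t) x) (Ioo 0 T) := by
        refine Integrable.mono' (hρu.integral_norm_prod_left.const_mul Cη')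
          (hfm.comp_measurable (g := fun t : ℝ => (t, x)) (by fun_prop)).aestronglyMeasurable ?_
        filter_upwards [hbound] with t ht using ht x
      have := weak_chain_rule hT hf hg
        (fun ψ h1 h2 h3 => hsol.mollify hρ0 hρ₀0 hη hηr hxr h1 h2 h3)
        (hβ.of_le (by simp)) hβK (hψs.of_le (by simp)) hψt
      simpa only [deriv_partial_time hφs] using this
    · have h0 : ∀ t, (t, x) ∉ tsupport φ := fun t ht => hx ⟨_, ht, rfl⟩
      have h1 : ∀ t, φ (t, x) = 0 := fun t => image_eq_zero_of_notMem_tsupport (h0 t)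
      have h2 : ∀ t, fderiv ℝ φ (t, x) = 0 := fun t =>
        image_eq_zero_of_notMem_tsupport fun h => h0 t (tsupport_fderiv_subset ℝ h)
      simp [h1, h2]
  have i2 : Integrable fun x => φ (0, x) * β (mollify η ρ₀ x) := by
    have hc : Continuous fun x => φ (0, x) * β (mollify η ρ₀ x) := by
      have h1 := hφs.continuous
      have h2 := hβ.continuous
      have h3 := (contDiff_mollify hη hηc hρ₀).continuous
      fun_prop
    refine hc.integrable_of_hasCompactSupport
      (HasCompactSupport.of_support_subset_isCompact hS fun x hx => ?_)
    exact ⟨(0, x), subset_tsupport _ (left_ne_zero_of_mul hx), rfl⟩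
  have i12 : Integrable fun x =>
      (∫ t in Ioo 0 T, fderiv ℝ φ (t, x) (1, 0) * β (mollify η (ρ t) x)) +
        φ (0, x) * β (mollify η ρ₀ x) := i1.integral_prod_right.add i2
  rw [integral_prod_symm _ i1, integral_prod_symm _ i3, ← integral_add i1.integral_prod_right i2,
    ← integral_add i12 i3.integral_prod_right]
  simp only [hpt, integral_zero]

end SpaceTime

/-! ### Removing the mollification, for smooth renormalizations. -/

section Limit

variable {N : ℕ}

/-- A sequence of bump functions with support shrinking to the origin. -/
noncomputable def shrinkingBump (E : Type*) [NormedAddCommGroup E] (n : ℕ) :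
    ContDiffBump (0 : E) :=
  ⟨1 / ((n : ℝ) + 1), 2 * (1 / ((n : ℝ) + 1)), by positivity, by
    have : (0 : ℝ) < 1 / ((n : ℝ) + 1) := by positivity
    linarith⟩

theorem tendsto_shrinkingBump_rOut (E : Type*) [NormedAddCommGroup E] :
    Tendsto (fun n => (shrinkingBump E n).rOut) atTop (𝓝 0) := by
  have := (tendsto_one_div_add_atTop_nhds_zero_nat (𝕜 := ℝ)).const_mul 2
  rwa [mul_zero] at this

/-- Lebesgue differentiation, applicable because the ratio of the two radii stays equal to 2. -/
theorem ae_tendsto_mollify {ρ : Rn N → ℝ} (hρ : Integrable ρ) :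
    ∀ᵐ x, Tendsto (fun n => mollify ((shrinkingBump (Rn N) n).normed volume) ρ x) atTop
      (𝓝 (ρ x)) := by
  have := ContDiffBump.ae_convolution_tendsto_right_of_locallyIntegrable (K := 2)
    (tendsto_shrinkingBump_rOut (Rn N)) (Eventually.of_forall fun n => le_rfl)
    hρ.locallyIntegrable
  filter_upwards [this] with x hx
  refine hx.congr fun n => ?_
  rw [convolution_lsmul_swap, mollify]
  simp only [smul_eq_mul, mul_comm]

theorem IsSpaceTimeTestFunction.integrable_fderiv_time {T : ℝ} {Ω : Set (Rn N)}
    {φ : ℝ × Rn N → ℝ} (hφ : IsSpaceTimeTestFunction T Ω φ) :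
    Integrable (fun z : ℝ × Rn N => fderiv ℝ φ z (1, 0))
      ((volume.restrict (Ioo 0 T)).prod volume) := by
  have hφd := hφ.1.continuous_fderiv (by simp)
  exact Continuous.integrable_of_hasCompactSupport (by fun_prop)
    ((hφ.2.1.fderiv (𝕜 := ℝ)).comp_left (g := fun L : (ℝ × Rn N) →L[ℝ] ℝ => L (1, 0)) rfl)

theorem IsSpaceTimeTestFunction.integrable_fderiv_space {T : ℝ} {Ω : Set (Rn N)}
    {φ : ℝ × Rn N → ℝ} (hφ : IsSpaceTimeTestFunction T Ω φ) {u : ℝ → Rn N → Rn N}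
    (hum : StronglyMeasurable fun z : ℝ × Rn N => u z.1 z.2)
    (hu : Integrable (fun z : ℝ × Rn N => u z.1 z.2)
      ((volume.restrict (Ioo 0 T)).prod volume)) :
    Integrable (fun z : ℝ × Rn N => fderiv ℝ φ z (0, u z.1 z.2))
      ((volume.restrict (Ioo 0 T)).prod volume) := by
  have hφd := hφ.1.continuous_fderiv (by simp)
  obtain ⟨C, hC⟩ := hφd.bounded_above_of_compact_support (hφ.2.1.fderiv (𝕜 := ℝ))
  refine (hu.norm.const_mul C).mono' ?_ (ae_of_all _ fun z => ?_)
  · exact ((isBoundedBilinearMap_apply (𝕜 := ℝ) (E := ℝ × Rn N)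
      (F := ℝ)).continuous.comp_stronglyMeasurable
        (hφd.stronglyMeasurable.prodMk (stronglyMeasurable_const.prodMk hum))).aestronglyMeasurable
  · refine (ContinuousLinearMap.le_opNorm _ _).trans ?_
    simp only [Prod.norm_mk, norm_zero, norm_nonneg, sup_of_le_right]
    exact mul_le_mul_of_nonneg_right (hC _) (norm_nonneg _)

theorem IsSpaceTimeTestFunction.integrable_initial {T : ℝ} {Ω : Set (Rn N)}
    {φ : ℝ × Rn N → ℝ} (hφ : IsSpaceTimeTestFunction T Ω φ) : Integrable fun x => φ (0, x) := by
  refine Continuous.integrable_of_hasCompactSupport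
    (by have := hφ.1.continuous; fun_prop)
    (HasCompactSupport.of_support_subset_isCompact
      (hφ.2.1.isCompact.image continuous_snd) fun x hx => ?_)
  exact ⟨(0, x), subset_tsupport _ hx, rfl⟩

/-- Renormalization for smooth `β`, in space-time form. -/
theorem renormalized_equation_of_smooth {Ω : Set (Rn N)} (hΩ : IsOpen Ω) {T : ℝ} (hT : 0 < T)
    {u : ℝ → Rn N → Rn N} {V : ℝ → Rn N → (Rn N →L[ℝ] Rn N)} {ρ₀ : Rn N → ℝ}
    {ρ : ℝ → Rn N → ℝ} (hsol : SatisfiesWeakTransport T Ω u ρ₀ ρ)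
    (hρm : StronglyMeasurable fun z : ℝ × Rn N => ρ z.1 z.2)
    (hum : StronglyMeasurable fun z : ℝ × Rn N => u z.1 z.2)
    (hVm : StronglyMeasurable fun z : ℝ × Rn N => V z.1 z.2)
    (hρ0 : ∀ t, ∀ x ∉ Ω, ρ t x = 0) (hu0 : ∀ t, ∀ x ∉ Ω, u t x = 0)
    (hV0 : ∀ t, ∀ x ∉ Ω, V t x = 0) (hρ₀0 : ∀ x ∉ Ω, ρ₀ x = 0) (hρ₀ : Integrable ρ₀) {M : ℝ}
    (hρ : ∀ᵐ t ∂(volume.restrict (Ioo 0 T)), Integrable (ρ t) ∧ ∫ y, ‖ρ t y‖ ≤ M)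
    (hu : Integrable (fun z : ℝ × Rn N => u z.1 z.2)
      ((volume.restrict (Ioo 0 T)).prod volume))
    (hρu : Integrable (fun z : ℝ × Rn N => ρ z.1 z.2 • u z.1 z.2)
      ((volume.restrict (Ioo 0 T)).prod volume))
    (hV : ∀ᵐ t ∂(volume.restrict (Ioo 0 T)), Integrable (V t))
    (huV : ∀ᵐ t ∂(volume.restrict (Ioo 0 T)), HasWeakFDerivOn Ω (u t) (V t))
    (hdiv : ∀ᵐ t ∂(volume.restrict (Ioo 0 T)), IsWeaklyDivFree Ω (u t))
    {b : ℝ → ℝ≥0∞} (hbm : AEMeasurable b (volume.restrict (Ioo 0 T)))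
    (hbi : ∫⁻ t in Ioo 0 T, b t ≠ ⊤)
    (hb : ∀ᵐ t ∂(volume.restrict (Ioo 0 T)), ∀ h : Rn N,
      ∫⁻ y, ‖ρ t (y + h) - ρ t y‖ₑ * ‖V t y‖ₑ ≤ b t)
    (hω : ∀ᵐ t ∂(volume.restrict (Ioo 0 T)), Tendsto (fun h : Rn N =>
      ∫⁻ y, ‖ρ t (y + h) - ρ t y‖ₑ * ‖V t y‖ₑ) (𝓝 0) (𝓝 0))
    {φ : ℝ × Rn N → ℝ} (hφ : IsSpaceTimeTestFunction T Ω φ)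
    {β : ℝ → ℝ} {Cβ : ℝ} {K : NNReal} (hβ : ContDiff ℝ ∞ β) (hβC : ∀ s, ‖β s‖ ≤ Cβ)
    (hβK : LipschitzWith K β) :
    (∫ z, fderiv ℝ φ z (1, 0) * β (ρ z.1 z.2) ∂((volume.restrict (Ioo 0 T)).prod volume)) +
      (∫ x, φ (0, x) * β (ρ₀ x)) -
      ∫ z, β (ρ z.1 z.2) * fderiv ℝ φ z (0, u z.1 z.2)
        ∂((volume.restrict (Ioo 0 T)).prod volume) = 0 := by
  obtain ⟨C₂, hC₂t, hC₂⟩ := exists_lintegral_fderiv_normed_le N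
  have hφ' := hφ
  obtain ⟨hφs, hφc, hφT⟩ := hφ'
  have hφd := hφs.continuous_fderiv (by simp)
  have hβ' : Continuous (deriv β) := hβ.continuous_deriv (by simp)
  obtain ⟨Cφ, hCφ⟩ := hφs.continuous.bounded_above_of_compact_support hφc
  have hCφ0 : 0 ≤ Cφ := (norm_nonneg _).trans (hCφ 0)
  have hS : IsCompact (Prod.snd '' tsupport φ) := hφc.isCompact.image continuous_snd
  have hSΩ : Prod.snd '' tsupport φ ⊆ Ω := by
    rintro _ ⟨z, hz, rfl⟩
    exact (hφT hz).2
  -- Half of `δ` is spent on the neighbourhood `U` of the support, the other half is room for the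
  -- mollifier.
  obtain ⟨δ, hδ, hδΩ⟩ := hS.exists_cthickening_subset_open hΩ hSΩ
  set U := Metric.thickening (δ / 2) (Prod.snd '' tsupport φ) with hU
  have hUΩ : ∀ x ∈ U, Metric.closedBall x (δ / 2) ⊆ Ω := by
    intro x hx y hy
    obtain ⟨k, hk, hxk⟩ := Metric.mem_thickening_iff.1 hx
    refine hδΩ (Metric.mem_cthickening_of_dist_le y k δ _ hk ?_)
    have := Metric.mem_closedBall.1 hy
    linarith [dist_triangle y x k]
  have hSU : Prod.snd '' tsupport φ ⊆ U := Metric.self_subset_thickening (by positivity) _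
  set η : ℕ → Rn N → ℝ := fun n => (shrinkingBump (Rn N) n).normed volume with hηdef
  have hη : ∀ n, ContDiff ℝ ∞ (η n) := fun n => ContDiffBump.contDiff_normed _
  have hηc : ∀ n, HasCompactSupport (η n) := fun n => ContDiffBump.hasCompactSupport_normed _
  have hηr : ∀ n, tsupport (η n) = Metric.closedBall 0 (shrinkingBump (Rn N) n).rOut := fun n =>
    ContDiffBump.tsupport_normed_eq _
  have hηC : ∀ n, ∫⁻ h, ‖fderiv ℝ (η n) h‖ₑ * ‖h‖ₑ ≤ C₂ := fun n => hC₂ _ rfl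
  have hlarge : ∀ᶠ n in atTop, (shrinkingBump (Rn N) n).rOut ≤ δ / 2 :=
    (tendsto_shrinkingBump_rOut (Rn N)).eventually_le_const (by positivity)
  have hmm := fun n => stronglyMeasurable_mollify_prod (hη n).continuous hρm
  -- convergence of the mollified densities
  have hconv : ∀ᵐ z ∂((volume.restrict (Ioo 0 T)).prod (volume : Measure (Rn N))),
      Tendsto (fun n => mollify (η n) (ρ z.1) z.2) atTop (𝓝 (ρ z.1 z.2)) := by
    rw [Measure.ae_prod_iff_ae_ae (measurableSet_tendsto_fun (fun n => (hmm n).measurable)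
      hρm.measurable)]
    filter_upwards [hρ] with t ht using ae_tendsto_mollify ht.1
  have hslice_int := hφ.integrable_fderiv_time
  have hDu := hφ.integrable_fderiv_space hum hu
  have hβmeas : ∀ n, AEStronglyMeasurable (fun z : ℝ × Rn N => β (mollify (η n) (ρ z.1) z.2))
      ((volume.restrict (Ioo 0 T)).prod volume) := fun n =>
    (hβ.continuous.comp_stronglyMeasurable (hmm n)).aestronglyMeasurable
  have i4 : ∀ n, Integrable (fun z : ℝ × Rn N => β (mollify (η n) (ρ z.1) z.2) *
      fderiv ℝ φ z (0, u z.1 z.2)) ((volume.restrict (Ioo 0 T)).prod volume) := fun n =>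
    hDu.bdd_mul (hβmeas n) (ae_of_all _ fun z => hβC _)
  -- limits of the first, second and fourth terms
  have L1 : Tendsto (fun n => ∫ z, fderiv ℝ φ z (1, 0) * β (mollify (η n) (ρ z.1) z.2)
      ∂((volume.restrict (Ioo 0 T)).prod volume)) atTop
      (𝓝 (∫ z, fderiv ℝ φ z (1, 0) * β (ρ z.1 z.2)
        ∂((volume.restrict (Ioo 0 T)).prod volume))) := by
    refine tendsto_integral_of_dominated_convergence
      (fun z => ‖fderiv ℝ φ z (1, 0)‖ * Cβ) (fun n => hslice_int.1.mul (hβmeas n))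
      (hslice_int.norm.mul_const _) (fun n => ae_of_all _ fun z => ?_) ?_
    · rw [norm_mul]
      gcongr
      exact hβC _
    · filter_upwards [hconv] with z hz
      exact ((hβ.continuous.tendsto _).comp hz).const_mul _
  have L2 : Tendsto (fun n => ∫ x, φ (0, x) * β (mollify (η n) ρ₀ x)) atTop
      (𝓝 (∫ x, φ (0, x) * β (ρ₀ x))) := by
    have h0 := hφ.integrable_initial
    refine tendsto_integral_of_dominated_convergence
      (fun x => ‖φ (0, x)‖ * Cβ) (fun n => h0.1.mul
        (hβ.continuous.comp (contDiff_mollify (hη n) (hηc n) hρ₀).continuous).aestronglyMeasurable)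
      (h0.norm.mul_const _) (fun n => ae_of_all _ fun z => ?_) ?_
    · rw [norm_mul]
      gcongr
      exact hβC _
    · filter_upwards [ae_tendsto_mollify hρ₀] with z hz
      exact ((hβ.continuous.tendsto _).comp hz).const_mul _
  have L4 : Tendsto (fun n => ∫ z, β (mollify (η n) (ρ z.1) z.2) * fderiv ℝ φ z (0, u z.1 z.2)
      ∂((volume.restrict (Ioo 0 T)).prod volume)) atTop
      (𝓝 (∫ z, β (ρ z.1 z.2) * fderiv ℝ φ z (0, u z.1 z.2)
        ∂((volume.restrict (Ioo 0 T)).prod volume))) := by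
    refine tendsto_integral_of_dominated_convergence
      (fun z => Cβ * ‖fderiv ℝ φ z (0, u z.1 z.2)‖) (fun n => (i4 n).1)
      (hDu.norm.const_mul _) (fun n => ae_of_all _ fun z => ?_) ?_
    · rw [norm_mul]
      gcongr
      exact hβC _
    · filter_upwards [hconv] with z hz
      exact ((hβ.continuous.tendsto _).comp hz).mul_const _
  -- the renormalization defect
  set D : ℕ → ℝ → ℝ := fun n t =>
    (∫ x, φ (t, x) * (deriv β (mollify (η n) (ρ t) x) *
      mollifiedFlux (η n) (ρ t) (u t) x)) +
      ∫ x, β (mollify (η n) (ρ t) x) * fderiv ℝ φ (t, x) (0, u t x) with hD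
  -- `A` is left free because it is used twice: `A = b t` gives the majorant in time, arbitrarily
  -- small `A` the pointwise limit.
  have hDle : ∀ᵐ t ∂(volume.restrict (Ioo 0 T)), ∀ n, (shrinkingBump (Rn N) n).rOut ≤ δ / 2 →
      ∀ A : ℝ≥0∞, (∀ h : Rn N, ‖h‖ ≤ (shrinkingBump (Rn N) n).rOut →
        ∫⁻ y, ‖ρ t (y + h) - ρ t y‖ₑ * ‖V t y‖ₑ ≤ A) →
      ‖D n t‖ₑ ≤ ENNReal.ofReal (Cφ * K) * (C₂ * (2 * A)) := by
    filter_upwards [hρ, hu.prod_right_ae, hρu.prod_right_ae, hV, huV, hdiv]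
      with t h1 h2 h3 h4 h5 h6 n hn A hA
    have hts : tsupport (fun x => φ (t, x)) ⊆ Prod.snd '' tsupport φ :=
      (tsupport_comp_subset_preimage φ (by fun_prop)).trans fun x hx => ⟨(t, x), hx, rfl⟩
    have hmk : Measurable fun x : Rn N => (t, x) := by fun_prop
    have key := enorm_renormalization_defect_le (U := U) (φ := fun x => φ (t, x)) (β := β)
      (C := Cφ * K) Metric.isOpen_thickening h5 h1.1 h2 h4 h3 (hρm.comp_measurable hmk)
      (hum.comp_measurable hmk) (hVm.comp_measurable hmk) (hu0 t) (hV0 t) h6 (hη n) (hηc n)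
      (hηr n).subset (fun x hx => (Metric.closedBall_subset_closedBall hn).trans (hUΩ x hx)) hA
      (hφs.comp (contDiff_const.prodMk contDiff_id))
      (hS.of_isClosed_subset (isClosed_tsupport _) hts) (hts.trans hSU) (hts.trans hSΩ) hβ
      (fun x s => by
        rw [norm_mul]
        gcongr
        · exact hCφ _
        · exact norm_deriv_le_of_lipschitz hβK)
    simp only [fderiv_partial_space hφs] at key
    refine key.trans ?_
    gcongr
    exact hηC n
  have heq : ∀ᶠ n in atTop, Integrable (D n) (volume.restrict (Ioo 0 T)) ∧
      (∫ z, fderiv ℝ φ z (1, 0) * β (mollify (η n) (ρ z.1) z.2)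
        ∂((volume.restrict (Ioo 0 T)).prod volume)) +
      (∫ x, φ (0, x) * β (mollify (η n) ρ₀ x)) + (∫ t in Ioo 0 T, D n t) -
      ∫ z, β (mollify (η n) (ρ z.1) z.2) * fderiv ℝ φ z (0, u z.1 z.2)
        ∂((volume.restrict (Ioo 0 T)).prod volume) = 0 := by
    filter_upwards [hlarge] with n hn
    obtain ⟨i3, h3⟩ := mollified_renormalized_equation hT hsol hρm hum hρ0 hρ₀0 hρ₀ hρ hρu (hη n)
      (hηc n) (hηr n).subset hφ
      (fun z hz => (Metric.closedBall_subset_closedBall hn).trans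
        (hUΩ _ (hSU (mem_image_of_mem _ hz)))) hβ hβC hβK
    refine ⟨i3.integral_prod_left.add (i4 n).integral_prod_left, ?_⟩
    have : ∫ t in Ioo 0 T, D n t = (∫ z, φ z * (deriv β (mollify (η n) (ρ z.1) z.2) *
        mollifiedFlux (η n) (ρ z.1) (u z.1) z.2) ∂((volume.restrict (Ioo 0 T)).prod volume)) +
        ∫ z, β (mollify (η n) (ρ z.1) z.2) * fderiv ℝ φ z (0, u z.1 z.2)
          ∂((volume.restrict (Ioo 0 T)).prod volume) := by
      rw [integral_prod _ i3, integral_prod _ (i4 n),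
        ← integral_add i3.integral_prod_left (i4 n).integral_prod_left]
    rw [this]
    linarith
  have hCt : ∀ A : ℝ≥0∞, A ≠ ⊤ → ENNReal.ofReal (Cφ * K) * (C₂ * (2 * A)) ≠ ⊤ := fun A hA =>
    ENNReal.mul_ne_top ENNReal.ofReal_ne_top
      (ENNReal.mul_ne_top hC₂t (ENNReal.mul_ne_top (by simp) hA))
  have L3 : Tendsto (fun n => ∫ t in Ioo 0 T, D n t) atTop (𝓝 0) := by
    suffices hs : Tendsto (fun n => ∫ t in Ioo 0 T, D n t) atTop
        (𝓝 (∫ _ in Ioo 0 T, (0 : ℝ))) by simpa using hs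
    refine tendsto_integral_filter_of_dominated_convergence
      (fun t => (ENNReal.ofReal (Cφ * K) * (C₂ * (2 * b t))).toReal)
      (heq.mono fun n hn => hn.1.1) ?_ ?_ ?_
    · filter_upwards [hlarge] with n hn
      filter_upwards [hDle, hb, ae_lt_top' hbm hbi] with t h1 h2 h3
      rw [← toReal_enorm]
      exact ENNReal.toReal_mono (hCt _ h3.ne) (h1 n hn _ fun h _ => h2 h)
    · refine integrable_toReal_of_lintegral_ne_top (by fun_prop) ?_
      rw [lintegral_const_mul'' _ (by fun_prop), lintegral_const_mul'' _ (by fun_prop),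
        lintegral_const_mul'' _ hbm]
      exact hCt _ hbi
    · filter_upwards [hDle, hω] with t h1 h2
      rw [tendsto_zero_iff_enorm_tendsto_zero, ENNReal.tendsto_nhds_zero]
      intro ε hε
      have hlim : Tendsto (fun A : ℝ≥0∞ => ENNReal.ofReal (Cφ * K) * (C₂ * (2 * A)))
          (𝓝 0) (𝓝 0) := by
        have := ENNReal.Tendsto.const_mul (a := ENNReal.ofReal (Cφ * K))
          (ENNReal.Tendsto.const_mul (a := C₂) (ENNReal.Tendsto.const_mul (a := 2)
            (tendsto_id (x := 𝓝 (0 : ℝ≥0∞))) (Or.inr (by simp))) (Or.inr hC₂t))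
          (Or.inr ENNReal.ofReal_ne_top)
        simpa using this
      obtain ⟨A, hA0, hA⟩ : ∃ A : ℝ≥0∞, 0 < A ∧
          ENNReal.ofReal (Cφ * K) * (C₂ * (2 * A)) ≤ ε := by
        have := ENNReal.tendsto_nhds_zero.1 hlim ε hε
        obtain ⟨a, ha, hs⟩ := ENNReal.nhds_zero_basis_Iic.mem_iff.1 this
        exact ⟨a, ha, hs (mem_Iic.2 le_rfl)⟩
      obtain ⟨r, hr, hr'⟩ := Metric.eventually_nhds_iff.1 (ENNReal.tendsto_nhds_zero.1 h2 A hA0)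
      filter_upwards [hlarge, (tendsto_shrinkingBump_rOut (Rn N)).eventually_lt_const hr]
        with n hn hn'
      refine (h1 n hn A fun h hh => hr' ?_).trans hA
      rw [dist_zero_right]
      exact hh.trans_lt hn'
  have hlim := ((L1.add L2).add L3).sub L4
  rw [add_zero] at hlim
  exact tendsto_nhds_unique (hlim.congr' (heq.mono fun n hn => hn.2)) tendsto_const_nhds

end Limit

/-! ### From smooth to Lipschitz renormalizations. -/

section Approximation

/-- An integral identity that holds for all smooth bounded Lipschitz functions `β` extends to all
bounded Lipschitz functions. -/
theorem integral_identity_of_smooth {α α' : Type*} [MeasurableSpace α] [MeasurableSpace α']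
    {μ : Measure α} {ν : Measure α'} {f w₁ w₂ : α → ℝ} {g w₃ : α' → ℝ}
    (hf : AEStronglyMeasurable f μ) (hg : AEStronglyMeasurable g ν) (hw₁ : Integrable w₁ μ)
    (hw₂ : Integrable w₂ μ) (hw₃ : Integrable w₃ ν) {C : ℝ} {K : NNReal}
    (h : ∀ β : ℝ → ℝ, ContDiff ℝ ∞ β → (∀ s, ‖β s‖ ≤ C) → LipschitzWith K β →
      (∫ a, w₁ a * β (f a) ∂μ) + (∫ a, w₃ a * β (g a) ∂ν) - ∫ a, β (f a) * w₂ a ∂μ = 0)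
    {β : ℝ → ℝ} (hβC : ∀ s, ‖β s‖ ≤ C) (hβK : LipschitzWith K β) :
    (∫ a, w₁ a * β (f a) ∂μ) + (∫ a, w₃ a * β (g a) ∂ν) - ∫ a, β (f a) * w₂ a ∂μ = 0 := by
  set κ : ℕ → ℝ → ℝ := fun n => (shrinkingBump ℝ n).normed volume with hκ
  have hκi : ∀ n, Integrable (κ n) := fun n => (shrinkingBump ℝ n).integrable_normed
  have hκ0 : ∀ n s, 0 ≤ κ n s := fun n s => (shrinkingBump ℝ n).nonneg_normed s
  have hκ1 : ∀ n, ∫ s, κ n s = 1 := fun n => (shrinkingBump ℝ n).integral_normed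
  -- A nonnegative kernel of mass one preserves both the bound `C` and the Lipschitz constant `K`.
  -- The identity contains no `β'`, so pointwise convergence of `B n` is enough.
  set B : ℕ → ℝ → ℝ := fun n => convolution (κ n) β (ContinuousLinearMap.lsmul ℝ ℝ) volume with hB
  have hBapp : ∀ n s, B n s = ∫ y, κ n y * β (s - y) := fun n s => rfl
  have hint : ∀ n s, Integrable fun y => κ n y * β (s - y) := fun n s =>
    (hκi n).mul_bdd (c := C)
      (hβK.continuous.comp (continuous_const.sub continuous_id)).aestronglyMeasurable
      (ae_of_all _ fun y => hβC _)
  have hBs : ∀ n, ContDiff ℝ ∞ (B n) := fun n =>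
    (shrinkingBump ℝ n).hasCompactSupport_normed.contDiff_convolution_left _
      (shrinkingBump ℝ n).contDiff_normed hβK.continuous.locallyIntegrable
  have hBC : ∀ n s, ‖B n s‖ ≤ C := by
    intro n s
    rw [hBapp]
    calc _ ≤ ∫ y, κ n y * C := by
          refine norm_integral_le_of_norm_le ((hκi n).mul_const C) (ae_of_all _ fun y => ?_)
          rw [norm_mul, Real.norm_of_nonneg (hκ0 n y)]
          exact mul_le_mul_of_nonneg_left (hβC _) (hκ0 n y)
      _ = C := by rw [integral_mul_const, hκ1, one_mul]
  have hBK : ∀ n, LipschitzWith K (B n) := by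
    intro n
    refine LipschitzWith.of_dist_le_mul fun s s' => ?_
    rw [dist_eq_norm, hBapp, hBapp, ← integral_sub (hint n s) (hint n s')]
    calc _ ≤ ∫ y, κ n y * (K * dist s s') := by
          refine norm_integral_le_of_norm_le ((hκi n).mul_const _) (ae_of_all _ fun y => ?_)
          rw [← mul_sub, norm_mul, Real.norm_of_nonneg (hκ0 n y), ← dist_eq_norm]
          refine mul_le_mul_of_nonneg_left ((hβK.dist_le_mul _ _).trans_eq ?_) (hκ0 n y)
          rw [dist_sub_right]
      _ = K * dist s s' := by rw [integral_mul_const, hκ1, one_mul]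
  have hBt : ∀ s, Tendsto (fun n => B n s) atTop (𝓝 (β s)) := fun s =>
    ContDiffBump.convolution_tendsto_right_of_continuous (tendsto_shrinkingBump_rOut ℝ)
      hβK.continuous s
  have L1 : Tendsto (fun n => ∫ a, w₁ a * B n (f a) ∂μ) atTop (𝓝 (∫ a, w₁ a * β (f a) ∂μ)) := by
    refine tendsto_integral_of_dominated_convergence (fun a => ‖w₁ a‖ * C)
      (fun n => hw₁.1.mul ((hBs n).continuous.comp_aestronglyMeasurable hf))
      (hw₁.norm.mul_const _) (fun n => ae_of_all _ fun a => ?_)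
      (ae_of_all _ fun a => (hBt _).const_mul _)
    rw [norm_mul]
    exact mul_le_mul_of_nonneg_left (hBC _ _) (norm_nonneg _)
  have L3 : Tendsto (fun n => ∫ a, w₃ a * B n (g a) ∂ν) atTop (𝓝 (∫ a, w₃ a * β (g a) ∂ν)) := by
    refine tendsto_integral_of_dominated_convergence (fun a => ‖w₃ a‖ * C)
      (fun n => hw₃.1.mul ((hBs n).continuous.comp_aestronglyMeasurable hg))
      (hw₃.norm.mul_const _) (fun n => ae_of_all _ fun a => ?_)
      (ae_of_all _ fun a => (hBt _).const_mul _)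
    rw [norm_mul]
    exact mul_le_mul_of_nonneg_left (hBC _ _) (norm_nonneg _)
  have L2 : Tendsto (fun n => ∫ a, B n (f a) * w₂ a ∂μ) atTop (𝓝 (∫ a, β (f a) * w₂ a ∂μ)) := by
    refine tendsto_integral_of_dominated_convergence (fun a => C * ‖w₂ a‖)
      (fun n => ((hBs n).continuous.comp_aestronglyMeasurable hf).mul hw₂.1)
      (hw₂.norm.const_mul _) (fun n => ae_of_all _ fun a => ?_)
      (ae_of_all _ fun a => (hBt _).mul_const _)
    rw [norm_mul]
    exact mul_le_mul_of_nonneg_right (hBC _ _) (norm_nonneg _)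
  refine tendsto_nhds_unique ((L1.add L3).sub L2) ?_
  simp only [h _ (hBs _) (hBC _) (hBK _)]
  exact tendsto_const_nhds

end Approximation

/-! ### Measurable representatives, extension by zero and the space-time weak form. -/

section Extension

variable {N : ℕ} {F : Type*} [NormedAddCommGroup F]

/-- A finite exponent makes the norm a power of a partial integral. For the density, whose exponent
may be `∞`, a constant essential bound in time is used instead. -/
theorem measurable_eLpNorm_slice {q : ℝ≥0∞} (hq0 : q ≠ 0) (hq : q ≠ ⊤) {g : ℝ → Rn N → F}
    (hg : StronglyMeasurable fun z : ℝ × Rn N => g z.1 z.2) :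
    Measurable fun t => eLpNorm (g t) q volume := by
  simp only [eLpNorm_eq_lintegral_rpow_enorm_toReal hq0 hq]
  exact (Measurable.lintegral_prod_right' (f := fun z : ℝ × Rn N => ‖g z.1 z.2‖ₑ ^ q.toReal)
    (hg.enorm.pow_const _)).pow_const _

/-- A function in `L^r(0,T;L^p(Ω))` has a strongly measurable representative, extended by zero
outside `Ω`. -/
theorem MemLpLp.exists_extension {T : ℝ} {Ω : Set (Rn N)} (hΩ : MeasurableSet Ω) {r p : ℝ≥0∞}
    {f : ℝ → Rn N → F} (hf : MemLpLp T Ω r p f) :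
    ∃ g : ℝ → Rn N → F, StronglyMeasurable (fun z : ℝ × Rn N => g z.1 z.2) ∧
      (∀ t, ∀ x ∉ Ω, g t x = 0) ∧
      (∀ᵐ t ∂(volume.restrict (Ioo 0 T)), f t =ᵐ[volume.restrict Ω] g t) ∧
      eLpNorm (fun t => eLpNorm (g t) p volume) r (volume.restrict (Ioo 0 T)) < ⊤ := by
  have hae : ∀ᵐ t ∂(volume.restrict (Ioo 0 T)),
      f t =ᵐ[volume.restrict Ω] Ω.indicator fun x => hf.1.mk _ (t, x) := by
    filter_upwards [Measure.ae_ae_of_ae_prod hf.1.ae_eq_mk] with t ht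
    filter_upwards [ht, ae_restrict_mem hΩ] with x hx hxΩ
    rw [indicator_of_mem hxΩ, ← hx]
  refine ⟨fun t => Ω.indicator fun x => hf.1.mk _ (t, x), ?_,
    fun t x hx => indicator_of_notMem hx _, hae, ?_⟩
  · have := hf.1.stronglyMeasurable_mk.indicator
      (MeasurableSet.univ.prod hΩ : MeasurableSet ((univ : Set ℝ) ×ˢ Ω))
    refine (congrArg StronglyMeasurable (funext fun z => ?_)).mp this
    by_cases hz : z.2 ∈ Ω <;> simp [hz]
  · refine lt_of_eq_of_lt (eLpNorm_congr_ae ?_) hf.2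
    filter_upwards [hae] with t ht
    rw [eLpNorm_congr_ae ht, ← eLpNorm_indicator_eq_eLpNorm_restrict hΩ, indicator_indicator,
      inter_self]

theorem SatisfiesWeakTransport.congr_ae {T : ℝ} {Ω : Set (Rn N)} {u u' : ℝ → Rn N → Rn N}
    {ρ₀ ρ₀' : Rn N → ℝ} {ρ ρ' : ℝ → Rn N → ℝ}
    (hu : ∀ᵐ t ∂(volume.restrict (Ioo 0 T)), u t =ᵐ[volume.restrict Ω] u' t)
    (hρ : ∀ᵐ t ∂(volume.restrict (Ioo 0 T)), ρ t =ᵐ[volume.restrict Ω] ρ' t)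
    (hρ₀ : ρ₀ =ᵐ[volume.restrict Ω] ρ₀') (h : SatisfiesWeakTransport T Ω u ρ₀ ρ) :
    SatisfiesWeakTransport T Ω u' ρ₀' ρ' := by
  intro φ hφ
  refine Eq.trans ?_ (h φ hφ)
  congr 1
  · congr 1
    · congr 1
      refine integral_congr_ae ?_
      filter_upwards [hρ] with t ht
      refine (integral_congr_ae ?_).symm
      filter_upwards [ht] with x hx
      rw [hx]
    · refine (integral_congr_ae ?_).symm
      filter_upwards [hρ₀] with x hx
      rw [hx]
  · refine integral_congr_ae ?_
    filter_upwards [hρ, hu] with t ht ht'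
    refine (integral_congr_ae ?_).symm
    filter_upwards [ht, ht'] with x hx hx'
    rw [hx, hx']

theorem IsWeaklyDivFree.congr_ae {Ω : Set (Rn N)} {v v' : Rn N → Rn N}
    (hv : v =ᵐ[volume.restrict Ω] v') (h : IsWeaklyDivFree Ω v) : IsWeaklyDivFree Ω v' := by
  intro φ hφ
  rw [← h φ hφ]
  refine integral_congr_ae ?_
  filter_upwards [hv] with x hx
  rw [hx]

theorem HasWeakFDerivOn.congr_ae {Ω : Set (Rn N)} {v v' : Rn N → Rn N}
    {V V' : Rn N → (Rn N →L[ℝ] Rn N)} (hv : v =ᵐ[volume.restrict Ω] v')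
    (hV : V =ᵐ[volume.restrict Ω] V') (hv' : Integrable v') (hV' : Integrable V')
    (h : HasWeakFDerivOn Ω v V) : HasWeakFDerivOn Ω v' V' := by
  refine ⟨hv'.locallyIntegrable.locallyIntegrableOn _, hV'.locallyIntegrable.locallyIntegrableOn _,
    fun φ hφ e => ?_⟩
  have e1 : ∫ x in Ω, fderiv ℝ φ x e • v' x = ∫ x in Ω, fderiv ℝ φ x e • v x := by
    refine integral_congr_ae ?_
    filter_upwards [hv] with x hx
    rw [hx]
  have e2 : ∫ x in Ω, φ x • V' x e = ∫ x in Ω, φ x • V x e := by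
    refine integral_congr_ae ?_
    filter_upwards [hV] with x hx
    rw [hx]
  rw [e1, e2, h.2.2 φ hφ e]

/-- The space-time form of the weak formulation. -/
theorem satisfiesWeakTransport_of_integral_prod {T : ℝ} {Ω : Set (Rn N)}
    {u : ℝ → Rn N → Rn N} {ρ₀ : Rn N → ℝ} {ρ : ℝ → Rn N → ℝ}
    (hum : StronglyMeasurable fun z : ℝ × Rn N => u z.1 z.2)
    (hu : Integrable (fun z : ℝ × Rn N => u z.1 z.2)
      ((volume.restrict (Ioo 0 T)).prod volume))
    (hρm : StronglyMeasurable fun z : ℝ × Rn N => ρ z.1 z.2) {C : ℝ}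
    (hρC : ∀ t x, ‖ρ t x‖ ≤ C)
    (h : ∀ φ, IsSpaceTimeTestFunction T Ω φ →
      (∫ z, fderiv ℝ φ z (1, 0) * ρ z.1 z.2 ∂((volume.restrict (Ioo 0 T)).prod volume)) +
      (∫ x, φ (0, x) * ρ₀ x) - ∫ z, ρ z.1 z.2 * fderiv ℝ φ z (0, u z.1 z.2)
        ∂((volume.restrict (Ioo 0 T)).prod volume) = 0) :
    SatisfiesWeakTransport T Ω u ρ₀ ρ := by
  intro φ hφ
  have key := h φ hφ
  have i1 := hφ.integrable_fderiv_time.mul_bdd hρm.aestronglyMeasurable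
    (ae_of_all _ fun z => hρC z.1 z.2)
  have i2 := (hφ.integrable_fderiv_space hum hu).bdd_mul hρm.aestronglyMeasurable
    (ae_of_all _ fun z => hρC z.1 z.2)
  rw [integral_prod _ i1, integral_prod _ i2] at key
  have h0 : ∀ t, ∀ x ∉ Ω, (t, x) ∉ tsupport φ := fun t x hx hc => hx (hφ.2.2 hc).2
  have hd0 : ∀ t, ∀ x ∉ Ω, fderiv ℝ φ (t, x) = 0 := fun t x hx =>
    image_eq_zero_of_notMem_tsupport fun hc => h0 t x hx (tsupport_fderiv_subset ℝ hc)
  have e1 : ∀ t, ∫ x in Ω, ρ t x * deriv (fun s => φ (s, x)) t =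
      ∫ x, fderiv ℝ φ (t, x) (1, 0) * ρ t x := by
    intro t
    simp only [deriv_partial_time hφ.1]
    rw [setIntegral_eq_integral_of_forall_compl_eq_zero fun x hx => by simp [hd0 t x hx]]
    simp only [mul_comm]
  have e2 : ∫ x in Ω, ρ₀ x * φ (0, x) = ∫ x, φ (0, x) * ρ₀ x := by
    rw [setIntegral_eq_integral_of_forall_compl_eq_zero fun x hx => by
      rw [image_eq_zero_of_notMem_tsupport (h0 0 x hx), mul_zero]]
    simp only [mul_comm]
  have e3 : ∀ t, ∫ x in Ω, ρ t x * fderiv ℝ (fun y => φ (t, y)) x (u t x) =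
      ∫ x, ρ t x * fderiv ℝ φ (t, x) (0, u t x) := by
    intro t
    simp only [fderiv_partial_space hφ.1]
    rw [setIntegral_eq_integral_of_forall_compl_eq_zero fun x hx => by simp [hd0 t x hx]]
  simp only [e1, e2, e3]
  linarith

end Extension

/-! ### Reduction of the theorem to the extended representatives. -/

section Reduction

variable {N : ℕ} {F : Type*} [NormedAddCommGroup F]

/-- Hölder against the indicator of `Ω`: when `Ω` has finite measure, `L^p` functions extended by
zero are integrable. -/
theorem lintegral_enorm_le_eLpNorm_mul {Ω : Set (Rn N)} (hΩ : MeasurableSet Ω) {p q : ℝ≥0∞}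
    (hpq : p.HolderConjugate q) {f : Rn N → F} (hf : AEStronglyMeasurable f)
    (hf0 : ∀ x ∉ Ω, f x = 0) :
    ∫⁻ x, ‖f x‖ₑ ≤ eLpNorm f p volume * eLpNorm (Ω.indicator fun _ => (1 : ℝ)) q volume := by
  refine le_trans (lintegral_mono fun x => ?_) (lintegral_enorm_mul_enorm_le hpq hf
    (aestronglyMeasurable_const.indicator hΩ))
  by_cases hx : x ∈ Ω <;> simp [hx, hf0]

theorem eLpNorm_indicator_one_ne_top {Ω : Set (Rn N)} (hΩ : MeasurableSet Ω)
    (hΩb : volume Ω ≠ ⊤) (q : ℝ≥0∞) :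
    eLpNorm (Ω.indicator fun _ => (1 : ℝ)) q volume ≠ ⊤ :=
  (memLp_indicator_const q hΩ (1 : ℝ) (Or.inr hΩb)).eLpNorm_ne_top

end Reduction

theorem mainTheorem4 {N : ℕ} (Ω : Set (Rn N)) (hΩ_open : IsOpen Ω) (hΩ_conn : IsConnected Ω)
    (hΩ_bdd : Bornology.IsBounded Ω) (T : ℝ) (hT : 0 < T)
    (p q : ℝ≥0∞) (hp : 1 < p) (hpq : p.HolderConjugate q)
    (u : ℝ → Rn N → Rn N) (hu : MemL1W1 T Ω q u)
    (hdiv : ∀ᵐ t ∂(volume.restrict (Ioo 0 T)), IsWeaklyDivFree Ω (u t))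
    (ρ₀ : Rn N → ℝ) (ρ : ℝ → Rn N → ℝ) (hρ : IsWeakSolution T Ω p u ρ₀ ρ) :
    IsRenormalizedSolution T Ω p u ρ₀ ρ := by
  refine ⟨hρ.memLp_initial, hρ.memLpLp, fun β hβ => ?_⟩
  obtain ⟨hβs, ⟨Cβ, hβC⟩, ⟨C', hβC'⟩⟩ := hβ
  have hβK : LipschitzWith C'.toNNReal β :=
    lipschitzWith_of_nnnorm_deriv_le (hβs.differentiable one_ne_zero) fun s => by
      rw [← NNReal.coe_le_coe, coe_nnnorm]
      exact (hβC' s).trans (Real.le_coe_toNNReal _)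
  have hΩm := hΩ_open.measurableSet
  have hΩt : volume Ω ≠ ⊤ := hΩ_bdd.measure_lt_top.ne
  -- This is where `p > 1` is indispensable: `q = ∞` would force `p = 1`.
  have hqt : q ≠ ⊤ := by
    rintro rfl
    have := hpq.inv_add_inv_eq_one
    simp only [ENNReal.inv_top, add_zero, ENNReal.inv_eq_one] at this
    exact hp.ne' this
  have hq0 : q ≠ 0 := by
    rintro rfl
    have := hpq.inv_add_inv_eq_one
    simp at this
  obtain ⟨hu1, Du, hDu, huDu⟩ := hu
  -- Zero extensions make translations and convolutions meaningful on all of `ℝ^N`; the weak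
  -- formulations see only the values on `Ω`, up to null sets.
  obtain ⟨ρ', hρm, hρ0, hρae, hρr⟩ := hρ.memLpLp.exists_extension hΩm
  obtain ⟨u', hum, hu0, huae, hur⟩ := hu1.exists_extension hΩm
  obtain ⟨V, hVm, hV0, hVae, hVr⟩ := hDu.exists_extension hΩm
  have hρt : ∀ t, StronglyMeasurable (ρ' t) := fun t =>
    hρm.comp_measurable (g := fun x : Rn N => (t, x)) (by fun_prop)
  have hut : ∀ t, StronglyMeasurable (u' t) := fun t =>
    hum.comp_measurable (g := fun x : Rn N => (t, x)) (by fun_prop)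
  have hVt : ∀ t, StronglyMeasurable (V t) := fun t =>
    hVm.comp_measurable (g := fun x : Rn N => (t, x)) (by fun_prop)
  rw [eLpNorm_exponent_top] at hρr
  set M := eLpNormEssSup (fun t => eLpNorm (ρ' t) p volume) (volume.restrict (Ioo 0 T)) with hM
  have hMle : ∀ᵐ t ∂(volume.restrict (Ioo 0 T)), eLpNorm (ρ' t) p volume ≤ M := by
    simpa only [enorm_eq_self] using ae_le_eLpNormEssSup
      (f := fun t => eLpNorm (ρ' t) p volume) (μ := volume.restrict (Ioo 0 T))
  simp only [eLpNorm_one_eq_lintegral_enorm, enorm_eq_self] at hur hVr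
  have hum_q := measurable_eLpNorm_slice hq0 hqt hum
  have hVm_q := measurable_eLpNorm_slice hq0 hqt hVm
  have hcp := eLpNorm_indicator_one_ne_top hΩm hΩt p
  have hcq := eLpNorm_indicator_one_ne_top hΩm hΩt q
  have hρint : ∀ᵐ t ∂(volume.restrict (Ioo 0 T)), Integrable (ρ' t) ∧ ∫ y, ‖ρ' t y‖ ≤
      (M * eLpNorm (Ω.indicator fun _ => (1 : ℝ)) q volume).toReal := by
    filter_upwards [hMle] with t ht
    have hle : ∫⁻ x, ‖ρ' t x‖ₑ ≤ M * eLpNorm (Ω.indicator fun _ => (1 : ℝ)) q volume :=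
      (lintegral_enorm_le_eLpNorm_mul hΩm hpq (hρt t).aestronglyMeasurable (hρ0 t)).trans
        (by gcongr)
    have hlt := ENNReal.mul_ne_top hρr.ne hcq
    refine ⟨⟨(hρt t).aestronglyMeasurable, hle.trans_lt hlt.lt_top⟩, ?_⟩
    rw [integral_norm_eq_lintegral_enorm (hρt t).aestronglyMeasurable]
    exact ENNReal.toReal_mono hlt hle
  have hui : Integrable (fun z : ℝ × Rn N => u' z.1 z.2)
      ((volume.restrict (Ioo 0 T)).prod volume) := by
    refine ⟨hum.aestronglyMeasurable, ?_⟩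
    rw [HasFiniteIntegral, lintegral_prod _ hum.enorm.aemeasurable]
    calc _ ≤ ∫⁻ t in Ioo 0 T, eLpNorm (u' t) q volume *
          eLpNorm (Ω.indicator fun _ => (1 : ℝ)) p volume :=
          lintegral_mono fun t =>
            lintegral_enorm_le_eLpNorm_mul hΩm hpq.symm (hut t).aestronglyMeasurable (hu0 t)
      _ < ⊤ := by
          rw [lintegral_mul_const _ hum_q]
          exact ENNReal.mul_lt_top hur hcp.lt_top
  have hρui : Integrable (fun z : ℝ × Rn N => ρ' z.1 z.2 • u' z.1 z.2)
      ((volume.restrict (Ioo 0 T)).prod volume) := by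
    have hsm : StronglyMeasurable fun z : ℝ × Rn N => ρ' z.1 z.2 • u' z.1 z.2 := hρm.smul hum
    refine ⟨hsm.aestronglyMeasurable, ?_⟩
    rw [HasFiniteIntegral, lintegral_prod _ hsm.enorm.aemeasurable]
    calc _ ≤ ∫⁻ t in Ioo 0 T, M * eLpNorm (u' t) q volume := by
          refine lintegral_mono_ae ?_
          filter_upwards [hMle] with t ht
          simp only [enorm_smul]
          exact (lintegral_enorm_mul_enorm_le hpq (hρt t).aestronglyMeasurable
            (hut t).aestronglyMeasurable).trans (by gcongr)
      _ < ⊤ := by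
          rw [lintegral_const_mul _ hum_q]
          exact ENNReal.mul_lt_top hρr hur
  have hVq : ∀ᵐ t ∂(volume.restrict (Ioo 0 T)), MemLp (V t) q := by
    filter_upwards [ae_lt_top hVm_q hVr.ne] with t ht
    exact ⟨(hVt t).aestronglyMeasurable, ht⟩
  have hVi : ∀ᵐ t ∂(volume.restrict (Ioo 0 T)), Integrable (V t) := by
    filter_upwards [hVq] with t ht
    exact ⟨ht.1, (lintegral_enorm_le_eLpNorm_mul hΩm hpq.symm ht.1 (hV0 t)).trans_lt
      (ENNReal.mul_lt_top ht.2 hcp.lt_top)⟩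
  have huV : ∀ᵐ t ∂(volume.restrict (Ioo 0 T)), HasWeakFDerivOn Ω (u' t) (V t) := by
    filter_upwards [huDu, huae, hVae, hui.prod_right_ae, hVi] with t h1 h2 h3 h4 h5
    exact h1.congr_ae h2 h3 h4 h5
  have hdiv' : ∀ᵐ t ∂(volume.restrict (Ioo 0 T)), IsWeaklyDivFree Ω (u' t) := by
    filter_upwards [hdiv, huae] with t h1 h2 using h1.congr_ae h2
  have hρ₀ae : ρ₀ =ᵐ[volume.restrict Ω] Ω.indicator ρ₀ := (indicator_ae_eq_restrict hΩm).symm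
  have hsol := hρ.weak_form.congr_ae huae hρae hρ₀ae
  have hρ₀i : Integrable (Ω.indicator ρ₀) := by
    have : IsFiniteMeasure (volume.restrict Ω) := ⟨by simpa using hΩt.lt_top⟩
    exact (integrable_indicator_iff hΩm).2 (hρ.memLp_initial.integrable hp.le)
  have hbd : ∀ᵐ t ∂(volume.restrict (Ioo 0 T)), ∀ h : Rn N,
      ∫⁻ y, ‖ρ' t (y + h) - ρ' t y‖ₑ * ‖V t y‖ₑ ≤ 2 * M * eLpNorm (V t) q volume := by
    filter_upwards [hMle] with t ht h
    exact (lintegral_translate_sub_mul_le hp.le hpq (hρt t).aestronglyMeasurable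
      (hVt t).aestronglyMeasurable h).trans (by gcongr)
  have hω : ∀ᵐ t ∂(volume.restrict (Ioo 0 T)), Tendsto (fun h : Rn N =>
      ∫⁻ y, ‖ρ' t (y + h) - ρ' t y‖ₑ * ‖V t y‖ₑ) (𝓝 0) (𝓝 0) := by
    filter_upwards [hMle, hρint, hVq] with t h1 h2 h3
    exact tendsto_lintegral_translate_sub_mul hp.le hqt hpq h2.1 (h1.trans_lt hρr).ne h3
  have hbi : ∫⁻ t in Ioo 0 T, 2 * M * eLpNorm (V t) q volume ≠ ⊤ := by
    rw [lintegral_const_mul _ hVm_q]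
    exact ENNReal.mul_ne_top (ENNReal.mul_ne_top (by simp) hρr.ne) hVr.ne
  have hfinal : SatisfiesWeakTransport T Ω u' (fun x => β (Ω.indicator ρ₀ x))
      (fun t x => β (ρ' t x)) := by
    refine satisfiesWeakTransport_of_integral_prod hum hui
      (hβs.continuous.comp_stronglyMeasurable hρm) (fun t x => hβC _) fun φ hφ => ?_
    exact integral_identity_of_smooth (f := fun z : ℝ × Rn N => ρ' z.1 z.2)
      hρm.aestronglyMeasurable hρ₀i.1 hφ.integrable_fderiv_time
      (hφ.integrable_fderiv_space hum hui) hφ.integrable_initial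
      (fun B h1 h2 h3 => renormalized_equation_of_smooth hΩ_open hT hsol hρm hum hVm hρ0 hu0 hV0
        (fun x hx => indicator_of_notMem hx _) hρ₀i hρint hui hρui hVi huV hdiv'
        (hVm_q.const_mul _).aemeasurable hbi hbd hω hφ h1 h2 h3) hβC hβK
  refine hfinal.congr_ae ?_ ?_ ?_
  · filter_upwards [huae] with t ht using ht.symm
  · filter_upwards [hρae] with t ht
    filter_upwards [ht] with x hx
    rw [hx]
  · filter_upwards [hρ₀ae] with x hx
    rw [← hx]
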